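/- **Setting.** Let $d\ge 2$ and $n\ge 1$ be integers. $\mathcal S(\mathcal H)$ denotes the set of positive semidefinite operators of unit trace on a finite-dimensional Hilbert space $\mathcal H$, and $\mathcal H_d=\mathbb C^d$. Let $\Phi$ be a quantum channel on $\mathcal H_d$ (a completely positive, trace preserving linear map on $d\times d$ matrices), let $\tau=(\Phi\otimes\mathrm{id})(|\Omega\rangle\langle\Omega|)$ with $|\Omega\rangle=\frac1{\sqrt d}\sum_{i=1}^d|i\,i\rangle$ be its Choi state, $\pi=\Phi(\mathbb I/d)$, and let $\mathrm{Tr}_2$ be the partial trace over the second factor. A unitary $2$-design is a probability distribution on a unitary group under which every polynomial of degree at most $2$ in the entries of $U$ and at most $2$ in the entries of $U^\dagger$ has the same expectation as under the Haar probability measure. Let $\nu$ be a $2$-design over pure states in $\mathcal S(\mathcal H_d^{\otimes n})$, i.e. the distribution of the pure state of $U|\phi_0\rangle$ for some fixed unit vector $|\phi_0\rangle$ and $U$ distributed according to some unitary $2$-design. Let $\nu^{(2)}$ be the distribution of $(\rho,\sigma)\sim\nu\times\nu$ conditioned on $\rho\ne\sigma$. For a channel $T$, the average contraction of the trace distance is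 $$\eta_1(T,\|\cdot\|_1,\nu^{(2)})=\mathbb E_{(\rho,\sigma)\sim\nu^{(2)}}\left[\frac{\frac12\|T(\rho)-T(\sigma)\|_1}{\frac12\|\rho-\sigma\|_1}\right],$$ where $\|\cdot\|_1$ is the trace norm (the sum of the singular values). **Statement.** The conditional distribution $\nu^{(2)}$ is a well-defined probability measure, the ratio above is integrable with respect to it, and the operator $d^n(\mathrm{Tr}_2\tau^2)^{\otimes n}-(\pi^2)^{\otimes n}$ is positive semidefinite. Moreover there is an absolute constant $C$ (independent of $d$, $n$, $\Phi$ and $\nu$) such that, for all such $d,n,\Phi,\nu$, $$\eta_1(\Phi^{\otimes n},\|\cdot\|_1,\nu^{(2)})\le \frac12\,\mathrm{Tr}\left(\frac{2}{d^n+1}\left[d^n(\mathrm{Tr}_2\tau^2)^{\otimes n}-(\pi^2)^{\otimes n}\right]\right)^{1/2}+\frac{C}{\sqrt{d^n}}$$ and $$\eta_1(\Phi^{\otimes n},\|\cdot\|_1,\nu^{(2)})\le\frac1{\sqrt2}\left(\mathrm{Tr}\sqrt{\mathrm{Tr}_2\tau^2}\right)^n+\frac{C}{\sqrt{d^n}}.$$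 Consequently, if $\mathrm{Tr}\sqrt{\mathrm{Tr}_2\tau^2}<1$, then the average contraction decays exponentially in $n$: there are constants $K$ and $0<c<1$, depending only on $d$ and $\Phi$, such that $\eta_1(\Phi^{\otimes n},\|\cdot\|_1,\nu^{(2)})\le K c^n$ for every $n\ge1$ and every $2$-design $\nu$ over pure states in $\mathcal S(\mathcal H_d^{\otimes n})$. -/

import Mathlib

open MeasureTheory
open scoped ComplexOrder MatrixOrder

noncomputable section

namespace QContraction

/-! ### States, trace norm, traces of square roots -/

/-- The quantum states on the Hilbert space with orthonormal basis indexed by `ι`: positive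
semidefinite matrices of unit trace. For `ι = Fin d` this is `S(H_d)`, and for `ι = Fin n → Fin d`
it is `S(H_d^{⊗ n})`, the basis vector with index `a` being `e_{a 0} ⊗ ⋯ ⊗ e_{a (n-1)}`. -/
abbrev QState (ι : Type) [Fintype ι] : Type :=
  {ρ : Matrix ι ι ℂ // ρ.PosSemidef ∧ ρ.trace = 1}

instance (ι : Type) [Fintype ι] : MeasurableSpace (QState ι) := borel _

instance (ι : Type) [Fintype ι] : BorelSpace (QState ι) := ⟨rfl⟩

/-- The trace norm (Schatten 1-norm): the sum of the singular values, that is, of the square roots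
of the eigenvalues of `Xᴴ X`. -/
def traceNorm {ι : Type} [Fintype ι] [DecidableEq ι] (X : Matrix ι ι ℂ) : ℝ :=
  ∑ i, √((Matrix.isHermitian_conjTranspose_mul_self X).eigenvalues i)

/-- The trace distance `(1/2) ‖X - Y‖₁`. -/
def traceDist {ι : Type} [Fintype ι] [DecidableEq ι] (X Y : Matrix ι ι ℂ) : ℝ :=
  1 / 2 * traceNorm (X - Y)

/-- `Tr √A` for a positive semidefinite matrix `A`, with the square root of the continuous
functional calculus. -/
def traceSqrt {ι : Type} [Fintype ι] [DecidableEq ι] (A : Matrix ι ι ℂ) : ℝ :=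
  (CFC.sqrt A).trace.re

/-! ### Channels -/

/-- `T ⊗ id` on matrices over the tensor product with a second system with basis indexed by `r`. -/
def ampliation {ι κ : Type} (r : Type) (T : Matrix ι ι ℂ →ₗ[ℂ] Matrix κ κ ℂ)
    (X : Matrix (ι × r) (ι × r) ℂ) : Matrix (κ × r) (κ × r) ℂ :=
  Matrix.of fun p q => T (Matrix.of fun i j => X (i, p.2) (j, q.2)) p.1 q.1

/-- Complete positivity: `T ⊗ id_k` preserves positive semidefiniteness for every `k`. -/
def IsCompletelyPositive {ι κ : Type} (T : Matrix ι ι ℂ →ₗ[ℂ] Matrix κ κ ℂ) : Prop :=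
  ∀ (k : ℕ) (X : Matrix (ι × Fin k) (ι × Fin k) ℂ), X.PosSemidef →
    (ampliation (Fin k) T X).PosSemidef

/-- Quantum channels: completely positive and trace preserving linear maps. -/
structure IsQuantumChannel {ι κ : Type} [Fintype ι] [Fintype κ]
    (T : Matrix ι ι ℂ →ₗ[ℂ] Matrix κ κ ℂ) : Prop where
  completelyPositive : IsCompletelyPositive T
  tracePreserving : ∀ X : Matrix ι ι ℂ, (T X).trace = X.trace

/-- The maximally entangled unit vector `Ω = d^{-1/2} ∑ i, e_i ⊗ e_i`. -/
def maxEntangled (ι : Type) [Fintype ι] [DecidableEq ι] : ι × ι → ℂ :=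
  fun p => if p.1 = p.2 then ((1 / √(Fintype.card ι : ℝ) : ℝ) : ℂ) else 0

/-- The Choi state `τ(T) = (T ⊗ id)(|Ω⟩⟨Ω|)`. -/
def choiState {ι κ : Type} [Fintype ι] [DecidableEq ι]
    (T : Matrix ι ι ℂ →ₗ[ℂ] Matrix κ κ ℂ) : Matrix (κ × ι) (κ × ι) ℂ :=
  ampliation ι T (Matrix.vecMulVec (maxEntangled ι) (star (maxEntangled ι)))

/-- The average output state `π(T) = T(I / d)`. -/
def averageOutput {ι κ : Type} [Fintype ι] [DecidableEq ι]
    (T : Matrix ι ι ℂ →ₗ[ℂ] Matrix κ κ ℂ) : Matrix κ κ ℂ :=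
  T ((Fintype.card ι : ℂ)⁻¹ • (1 : Matrix ι ι ℂ))

/-- The partial trace `Tr₂` over the second tensor factor. -/
def partialTrace₂ {κ ι : Type} [Fintype ι] (X : Matrix (κ × ι) (κ × ι) ℂ) : Matrix κ κ ℂ :=
  Matrix.of fun a b => ∑ i, X (a, i) (b, i)

/-- The tensor product `A 0 ⊗ ⋯ ⊗ A (n-1)` of matrices. -/
def tensorProd {n : ℕ} {ι κ : Type} (A : Fin n → Matrix ι κ ℂ) :
    Matrix (Fin n → ι) (Fin n → κ) ℂ :=
  Matrix.of fun a b => ∏ k, A k (a k) (b k)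

/-- The tensor power `A^{⊗ n}` of a matrix. -/
def tensorPow (n : ℕ) {ι κ : Type} (A : Matrix ι κ ℂ) : Matrix (Fin n → ι) (Fin n → κ) ℂ :=
  tensorProd fun _ => A

/-- The tensor power `Φ^{⊗ n}` of a linear map on matrices: the linear map that sends the matrix
unit `E_{ij} = E_{i_1 j_1} ⊗ ⋯ ⊗ E_{i_n j_n}` to `Φ(E_{i_1 j_1}) ⊗ ⋯ ⊗ Φ(E_{i_n j_n})`. -/
def channelPow (n : ℕ) {ι κ : Type} [Fintype ι] [DecidableEq ι]
    (Φ : Matrix ι ι ℂ →ₗ[ℂ] Matrix κ κ ℂ) :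
    Matrix (Fin n → ι) (Fin n → ι) ℂ →ₗ[ℂ] Matrix (Fin n → κ) (Fin n → κ) ℂ where
  toFun X := ∑ i : Fin n → ι, ∑ j : Fin n → ι,
    X i j • tensorProd fun k => Φ (Matrix.single (i k) (j k) 1)
  map_add' X Y := by simp [add_smul, Finset.sum_add_distrib]
  map_smul' c X := by simp [Finset.smul_sum, mul_smul]

/-- The defining property of `Φ^{⊗ n}` on product operators. -/
theorem channelPow_tensorProd (n : ℕ) {ι κ : Type} [Fintype ι] [DecidableEq ι]
    (Φ : Matrix ι ι ℂ →ₗ[ℂ] Matrix κ κ ℂ) (A : Fin n → Matrix ι ι ℂ) :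
    channelPow n Φ (tensorProd A) = tensorProd fun k => Φ (A k) := by
  have h : ∀ X : Matrix ι ι ℂ, Φ X = ∑ p : ι × ι, X p.1 p.2 • Φ (Matrix.single p.1 p.2 1) := by
    intro X
    conv_lhs => rw [Matrix.matrix_eq_sum_single X]
    simp only [map_sum]
    rw [Fintype.sum_prod_type]
    refine Finset.sum_congr rfl fun i _ => Finset.sum_congr rfl fun j _ => ?_
    rw [← map_smul, Matrix.smul_single, smul_eq_mul, mul_one]
  ext a b
  simp only [channelPow, tensorProd, LinearMap.coe_mk, AddHom.coe_mk, Matrix.sum_apply,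
    Matrix.smul_apply, Matrix.of_apply, smul_eq_mul]
  simp_rw [h (A _), Matrix.sum_apply, Matrix.smul_apply, smul_eq_mul]
  rw [Finset.prod_univ_sum, Fintype.piFinset_univ, ← Fintype.sum_prod_type']
  refine Fintype.sum_equiv (Equiv.arrowProdEquivProdArrow (Fin n) (fun _ => ι) (fun _ => ι)).symm
    _ _ fun p => ?_
  simp [Finset.prod_mul_distrib, Equiv.arrowProdEquivProdArrow]

/-! ### Designs -/

instance (ι : Type) [Fintype ι] [DecidableEq ι] :
    MeasurableSpace (Matrix.unitaryGroup ι ℂ) := borel _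

instance (ι : Type) [Fintype ι] [DecidableEq ι] : BorelSpace (Matrix.unitaryGroup ι ℂ) := ⟨rfl⟩

instance (ι : Type) [Fintype ι] [DecidableEq ι] : CompactSpace (Matrix.unitaryGroup ι ℂ) := by
  refine isCompact_iff_compactSpace (s := (Matrix.unitaryGroup ι ℂ : Set (Matrix ι ι ℂ))).mp ?_
  refine IsCompact.of_isClosed_subset
    (isCompact_univ_pi fun _ : ι => isCompact_univ_pi fun _ : ι =>
      isCompact_closedBall (0 : ℂ) 1) ?_ ?_
  · have : ((Matrix.unitaryGroup ι ℂ : Submonoid (Matrix ι ι ℂ)) : Set (Matrix ι ι ℂ)) =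
        {U | U * star U = 1} := by
      ext U
      exact Matrix.mem_unitaryGroup_iff
    rw [this]
    exact isClosed_eq (by fun_prop) continuous_const
  · intro U hU i _ j _
    simpa using entry_norm_bound_of_unitary hU i j

/-- The Haar probability measure on the unitary group. -/
def haarUnitary (ι : Type) [Fintype ι] [DecidableEq ι] : Measure (Matrix.unitaryGroup ι ℂ) :=
  Measure.haarMeasure ⊤

/-- The value at `U` of a polynomial in the entries of `U` (the variables `inl (i, j)`) and of
`U†` (the variables `inr (i, j)`). -/
def evalUnitary {ι : Type} [Fintype ι] [DecidableEq ι]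
    (P : MvPolynomial ((ι × ι) ⊕ (ι × ι)) ℂ) (U : Matrix.unitaryGroup ι ℂ) : ℂ :=
  MvPolynomial.eval
    (Sum.elim (fun p => (U : Matrix ι ι ℂ) p.1 p.2)
      (fun p => (star (U : Matrix ι ι ℂ)) p.1 p.2)) P

/-- The polynomial has degree at most `t` in the entries of `U` and degree at most `t` in the
entries of `U†`. -/
def HasBidegreeLE {ι : Type} [Fintype ι] (t : ℕ)
    (P : MvPolynomial ((ι × ι) ⊕ (ι × ι)) ℂ) : Prop :=
  ∀ m ∈ P.support, ∑ p : ι × ι, m (Sum.inl p) ≤ t ∧ ∑ p : ι × ι, m (Sum.inr p) ≤ t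

/-- Unitary `t`-designs: probability distributions on the unitary group that give every polynomial
of degree at most `t` in the entries of `U` and in those of `U†` its Haar average. -/
structure IsUnitaryDesign {ι : Type} [Fintype ι] [DecidableEq ι] (t : ℕ)
    (μ : Measure (Matrix.unitaryGroup ι ℂ)) : Prop where
  isProbabilityMeasure : IsProbabilityMeasure μ
  average : ∀ P : MvPolynomial ((ι × ι) ⊕ (ι × ι)) ℂ, HasBidegreeLE t P →
    ∫ U, evalUnitary P U ∂μ = ∫ U, evalUnitary P U ∂(haarUnitary ι)

/-- The pure state `|φ⟩⟨φ|` of a unit vector `φ`. -/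
def pureState {ι : Type} [Fintype ι] (φ : EuclideanSpace ℂ ι) (hφ : ‖φ‖ = 1) : QState ι :=
  ⟨Matrix.vecMulVec φ (star (φ : ι → ℂ)), Matrix.posSemidef_vecMulVec_self_star _, by
    have h := EuclideanSpace.norm_sq_eq φ
    rw [hφ] at h
    rw [Matrix.trace_vecMulVec, dotProduct]
    simp only [Pi.star_apply, RCLike.star_def, Complex.mul_conj, Complex.normSq_eq_norm_sq]
    exact_mod_cast h.symm.trans (by norm_num)⟩

/-- The state `U ρ U†`. For `ρ = |φ⟩⟨φ|` this is the pure state of the vector `U φ`. -/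
def conjState {ι : Type} [Fintype ι] [DecidableEq ι] (U : Matrix.unitaryGroup ι ℂ)
    (ρ : QState ι) : QState ι :=
  ⟨(U : Matrix ι ι ℂ) * ρ.1 * star (U : Matrix ι ι ℂ), by
    refine ⟨ρ.2.1.mul_mul_conjTranspose_same _, ?_⟩
    rw [Matrix.trace_mul_cycle, Matrix.UnitaryGroup.star_mul_self, Matrix.one_mul, ρ.2.2]⟩

theorem measurable_conjState {ι : Type} [Fintype ι] [DecidableEq ι] (ρ : QState ι) :
    Measurable fun U : Matrix.unitaryGroup ι ℂ => conjState U ρ := by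
  refine Continuous.measurable (Continuous.subtype_mk ?_ _)
  fun_prop

/-- `ν` is a `t`-design over pure states: it is the distribution of (the pure state of) `U φ₀`, for
some reference unit vector `φ₀` and `U` distributed according to some unitary `t`-design. -/
def IsStateDesign {ι : Type} [Fintype ι] [DecidableEq ι] (t : ℕ) (ν : Measure (QState ι)) : Prop :=
  ∃ (φ₀ : EuclideanSpace ℂ ι) (h₀ : ‖φ₀‖ = 1) (μ : Measure (Matrix.unitaryGroup ι ℂ)),
    IsUnitaryDesign t μ ∧ ν = μ.map fun U => conjState U (pureState φ₀ h₀)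

/-! ### Average contraction -/

/-- `ν^{(2)}`: the distribution of `(ρ, σ) ∼ ν × ν` conditioned on `ρ ≠ σ`. -/
def pairDistribution {ι : Type} [Fintype ι] (ν : Measure (QState ι)) :
    Measure (QState ι × QState ι) :=
  ProbabilityTheory.cond (ν.prod ν) {p | p.1 ≠ p.2}

/-- The ratio of the trace distances after and before the application of `T`. -/
def contractionRatio {ι κ : Type} [Fintype ι] [DecidableEq ι] [Fintype κ] [DecidableEq κ]
    (T : Matrix ι ι ℂ →ₗ[ℂ] Matrix κ κ ℂ) (p : QState ι × QState ι) : ℝ :=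
  traceDist (T p.1.1) (T p.2.1) / traceDist p.1.1 p.2.1

/-- The average contraction of the trace distance `η₁(T, ‖·‖₁, ω)`: the expectation of the
contraction ratio for `(ρ, σ) ∼ ω`. -/
def avgContraction {ι κ : Type} [Fintype ι] [DecidableEq ι] [Fintype κ] [DecidableEq κ]
    (T : Matrix ι ι ℂ →ₗ[ℂ] Matrix κ κ ℂ) (ω : Measure (QState ι × QState ι)) : ℝ :=
  ∫ p, contractionRatio T p ∂ω

end QContraction

end

open QContraction

namespace QContraction

/-! Put D = d^n, T = Φ^{⊗n} and X = ρ - σ. A 2-design reproduces the Haar second moments, so E[X ⊗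
X] = 2/(D(D+1)) (F - I/D), with F the swap. Hence M = E[T(X)²] depends only on T, and
multiplicativity over tensor factors turns it into 2/(D+1) [D (Tr₂ τ²)^{⊗n} - (π²)^{⊗n}]
(`IsStateDesign.integral_map_sq_apply`, `secondMoment_channelPow`). As an average of squares of
Hermitian matrices, M is positive.

Numerator: E‖T(X)‖₁ ≤ Tr √M is Jensen's inequality for the concave function Tr √·. It comes from
2‖Y‖₁ ≤ Tr(S⁻¹Y²) + Tr S, which is linear in Y², with S = √M + ε
(`IsStateDesign.integral_traceNorm_le`).

Denominator: two random pure states are almost orthogonal. The trace distance is at least 1 - Tr ρσ,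
the ratio is at most 1, and E Tr ρσ = 1/D, so replacing the denominator by 1 costs 1/D. Conditioning
on ρ ≠ σ costs another 1/D (`IsStateDesign.avgContraction_le`). The total error 2/D is at most 2/√D.

The second bound follows from M ≤ 2 (Tr₂ τ²)^{⊗n} and monotonicity of Tr √·, which factorises on
tensor powers. Exponential decay is then immediate.

The Haar moments are computed from left invariance alone: diagonal phases kill the unpaired ones,
one rational reflection relates the others, and normalisation fixes the constant (`haarMoment_eq`).
-/

theorem trace_re_nonneg {ι : Type} [Fintype ι] {A : Matrix ι ι ℂ} (hA : A.PosSemidef) :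
    0 ≤ A.trace.re :=
  (Complex.nonneg_iff.mp hA.trace_nonneg).1

theorem posDef_add_smul_one {ι : Type} [DecidableEq ι] {R : Matrix ι ι ℂ} (hR : R.PosSemidef)
    {ε : ℝ} (hε : 0 < ε) : (R + (ε : ℂ) • (1 : Matrix ι ι ℂ)).PosDef :=
  Matrix.PosDef.posSemidef_add hR (Matrix.PosDef.one.smul (by exact_mod_cast hε))

/-! ### Trace norm and trace of the square root: variational bounds. -/

section TraceNorm

variable {ι : Type} [Fintype ι] [DecidableEq ι]

theorem trace_cfc_re {A : Matrix ι ι ℂ} (hA : A.IsHermitian) (f : ℝ → ℝ) :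
    (cfc f A).trace.re = ∑ i, f (hA.eigenvalues i) := by
  rw [hA.cfc_eq, Matrix.IsHermitian.cfc, Unitary.conjStarAlgAut_apply, Matrix.trace_mul_cycle,
    Unitary.coe_star_mul_self, Matrix.one_mul, Matrix.trace_diagonal]
  simp

theorem traceSqrt_eq_sum {A : Matrix ι ι ℂ} (hA : A.PosSemidef) :
    traceSqrt A = ∑ i, √(hA.1.eigenvalues i) := by
  rw [traceSqrt, CFC.sqrt_eq_real_sqrt A hA.nonneg, cfcₙ_eq_cfc, trace_cfc_re hA.1]

theorem traceNorm_eq_traceSqrt (X : Matrix ι ι ℂ) :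
    traceNorm X = traceSqrt (X.conjTranspose * X) :=
  (traceSqrt_eq_sum (Matrix.posSemidef_conjTranspose_mul_self X)).symm

theorem traceNorm_eq_trace_abs (X : Matrix ι ι ℂ) :
    traceNorm X = (CFC.abs X).trace.re :=
  traceNorm_eq_traceSqrt X

theorem traceNorm_eq_sum_abs {X : Matrix ι ι ℂ} (hX : X.IsHermitian) :
    traceNorm X = ∑ i, |hX.eigenvalues i| := by
  rw [traceNorm_eq_trace_abs, CFC.abs_eq_cfc_norm X hX.isSelfAdjoint, trace_cfc_re hX]
  rfl

-- Continuity is not visible on the individually chosen eigenvalues; it is inherited from that of X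
-- ↦ |X|.
open scoped Matrix.Norms.L2Operator in
theorem continuous_traceNorm : Continuous (traceNorm : Matrix ι ι ℂ → ℝ) := by
  have h : (traceNorm : Matrix ι ι ℂ → ℝ) = fun X => (CFC.abs X).trace.re :=
    funext traceNorm_eq_trace_abs
  rw [h]
  exact Complex.continuous_re.comp ((CFC.continuous_abs (A := Matrix ι ι ℂ)).matrix_trace)

theorem traceNorm_nonneg (X : Matrix ι ι ℂ) : 0 ≤ traceNorm X :=
  Finset.sum_nonneg fun _ _ => Real.sqrt_nonneg _

theorem traceSqrt_nonneg (A : Matrix ι ι ℂ) : 0 ≤ traceSqrt A :=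
  (Complex.nonneg_iff.mp (Matrix.nonneg_iff_posSemidef.mp (CFC.sqrt_nonneg A)).trace_nonneg).1

/-- The trace of a product of two positive semidefinite matrices is nonnegative. -/
theorem trace_mul_re_nonneg {A B : Matrix ι ι ℂ} (hA : A.PosSemidef) (hB : B.PosSemidef) :
    0 ≤ (A * B).trace.re := by
  have h : A * B = CFC.sqrt A * (CFC.sqrt A * B) := by
    rw [← Matrix.mul_assoc, CFC.sqrt_mul_sqrt_self A hA.nonneg]
  rw [h, Matrix.trace_mul_comm]
  have h2 := hB.mul_mul_conjTranspose_same (CFC.sqrt A)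
  rw [(Matrix.nonneg_iff_posSemidef.mp (CFC.sqrt_nonneg A)).1.eq] at h2
  exact trace_re_nonneg h2

/-- `‖A - B‖₁ ≤ Tr A + Tr B` for positive semidefinite matrices. -/
theorem traceNorm_sub_le {A B : Matrix ι ι ℂ} (hA : A.PosSemidef) (hB : B.PosSemidef) :
    traceNorm (A - B) ≤ A.trace.re + B.trace.re := by
  have hX : (A - B).IsHermitian := hA.1.sub hB.1
  set U : Matrix ι ι ℂ := (hX.eigenvectorUnitary : Matrix ι ι ℂ) with hU
  have hUU : U * star U = 1 := Unitary.coe_mul_star_self _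
  have hUU' : star U * U = 1 := Unitary.coe_star_mul_self _
  -- In an eigenbasis of A - B each eigenvalue is a difference a - b of nonnegative diagonal
  -- entries, and |a - b| ≤ a + b.
  have hdiag : star U * (A - B) * U = Matrix.diagonal (RCLike.ofReal ∘ hX.eigenvalues) := by
    have h := hX.spectral_theorem
    rw [Unitary.conjStarAlgAut_apply] at h
    calc star U * (A - B) * U
        = star U * (U * Matrix.diagonal (RCLike.ofReal ∘ hX.eigenvalues) * star U) * U := by
          rw [← h]
      _ = (star U * U) * Matrix.diagonal (RCLike.ofReal ∘ hX.eigenvalues) * (star U * U) := by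
          simp only [Matrix.mul_assoc]
      _ = _ := by rw [hUU', Matrix.one_mul, Matrix.mul_one]
  have hA' := hA.conjTranspose_mul_mul_same U
  have hB' := hB.conjTranspose_mul_mul_same U
  have htr : ∀ Y : Matrix ι ι ℂ, (star U * Y * U).trace = Y.trace := fun Y => by
    rw [Matrix.trace_mul_cycle, hUU, Matrix.one_mul]
  rw [traceNorm_eq_sum_abs hX, ← htr A, ← htr B, Matrix.trace, Matrix.trace, Complex.re_sum,
    Complex.re_sum, ← Finset.sum_add_distrib]
  refine Finset.sum_le_sum fun i _ => ?_
  have ha : 0 ≤ ((star U * A * U) i i).re := (Complex.nonneg_iff.mp (hA'.diag_nonneg (i := i))).1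
  have hb : 0 ≤ ((star U * B * U) i i).re := (Complex.nonneg_iff.mp (hB'.diag_nonneg (i := i))).1
  have hi : hX.eigenvalues i = ((star U * A * U) i i).re - ((star U * B * U) i i).re := by
    rw [← Complex.sub_re, ← Matrix.sub_apply, ← Matrix.sub_mul, ← Matrix.mul_sub, hdiag]
    simp
  simp only [Matrix.diag_apply]
  rw [hi, abs_le]
  constructor <;> linarith

/-- Jordan decomposition: a Hermitian matrix is a difference of positive semidefinite matrices
whose traces add up to its trace norm. -/
theorem exists_jordan {X : Matrix ι ι ℂ} (hX : X.IsHermitian) :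
    ∃ P N : Matrix ι ι ℂ, P.PosSemidef ∧ N.PosSemidef ∧ X = P - N ∧
      traceNorm X = P.trace.re + N.trace.re := by
  refine ⟨X⁺, X⁻, Matrix.nonneg_iff_posSemidef.mp (CFC.posPart_nonneg X),
    (Matrix.nonneg_iff_posSemidef.mp (CFC.negPart_nonneg X)),
    (CFC.posPart_sub_negPart X hX.isSelfAdjoint).symm, ?_⟩
  rw [traceNorm_eq_trace_abs, ← CFC.posPart_add_negPart X hX.isSelfAdjoint, Matrix.trace_add,
    Complex.add_re]

/-- `2 Tr P ≤ Tr (S⁻¹ P²) + Tr S`. -/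
theorem two_mul_trace_le {P S : Matrix ι ι ℂ} (hP : P.PosSemidef) (hS : S.PosDef) :
    2 * P.trace.re ≤ (S⁻¹ * (P * P)).trace.re + S.trace.re := by
  have hu : IsUnit S.det := (Matrix.isUnit_iff_isUnit_det _).mp hS.isUnit
  -- Completing the square: (P - S) S⁻¹ (P - S) ≥ 0.
  have h := trace_re_nonneg (hS.inv.posSemidef.mul_mul_conjTranspose_same (P - S))
  have hconj : (P - S).conjTranspose = P - S := (hP.1.sub hS.1).eq
  have hexp : (P - S) * S⁻¹ * (P - S) = P * S⁻¹ * P - P - P + S := by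
    rw [Matrix.sub_mul, Matrix.mul_nonsing_inv _ hu, Matrix.mul_sub, Matrix.sub_mul,
      Matrix.sub_mul, Matrix.mul_assoc P S⁻¹ S, Matrix.nonsing_inv_mul _ hu, Matrix.mul_one,
      Matrix.one_mul, Matrix.one_mul]
    abel
  rw [hconj, hexp, Matrix.trace_add, Matrix.trace_sub, Matrix.trace_sub, Matrix.mul_assoc,
    Matrix.trace_mul_comm, Matrix.mul_assoc] at h
  simp only [Complex.add_re, Complex.sub_re] at h
  linarith

/-- `Tr ((R + ε)⁻¹ R²) ≤ Tr R`. -/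
theorem trace_inv_mul_sq_le {R : Matrix ι ι ℂ} (hR : R.PosSemidef) {ε : ℝ} (hε : 0 < ε) :
    ((R + (ε : ℂ) • (1 : Matrix ι ι ℂ))⁻¹ * (R * R)).trace.re ≤ R.trace.re := by
  have hS := posDef_add_smul_one hR hε
  set S := R + (ε : ℂ) • (1 : Matrix ι ι ℂ) with hSdef
  have hu : IsUnit S.det := (Matrix.isUnit_iff_isUnit_det _).mp hS.isUnit
  have h1 : S⁻¹ * (R * R) = R - (ε : ℂ) • (S⁻¹ * R) := by
    have : R * R = S * R - (ε : ℂ) • R := by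
      rw [hSdef, Matrix.add_mul, Matrix.smul_mul, Matrix.one_mul, add_sub_cancel_right]
    rw [this, Matrix.mul_sub, ← Matrix.mul_assoc, Matrix.nonsing_inv_mul _ hu, Matrix.one_mul,
      Matrix.mul_smul]
  have h2 := trace_mul_re_nonneg hS.inv.posSemidef hR
  rw [h1, Matrix.trace_sub, Matrix.trace_smul, Complex.sub_re, smul_eq_mul, Complex.re_ofReal_mul]
  nlinarith [mul_nonneg hε.le h2]

/-- Monotonicity of the trace of the square root. -/
theorem traceSqrt_le_of_le_sq {M R : Matrix ι ι ℂ} (hM : M.PosSemidef) (hR : R.PosSemidef)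
    (h : (R * R - M).PosSemidef) : traceSqrt M ≤ R.trace.re := by
  refine le_of_forall_pos_le_add fun δ hδ => ?_
  obtain ⟨ε, hε, hεδ⟩ : ∃ ε : ℝ, 0 < ε ∧ ε * (Fintype.card ι : ℝ) ≤ δ := by
    -- The + 1 keeps the denominator positive for an empty index type.
    refine ⟨δ / (Fintype.card ι + 1), by positivity, ?_⟩
    rw [div_mul_eq_mul_div, div_le_iff₀ (by positivity)]
    nlinarith
  have hS := posDef_add_smul_one hR hε
  -- Take P = √M and S = R + ε, where ε makes S invertible. Then Tr(S⁻¹M) ≤ Tr(S⁻¹R²) ≤ Tr R, so 2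
  -- Tr √M ≤ 2 Tr R + ε dim.
  have h1 := two_mul_trace_le (Matrix.nonneg_iff_posSemidef.mp (CFC.sqrt_nonneg M)) hS
  rw [CFC.sqrt_mul_sqrt_self M hM.nonneg] at h1
  have h2 := trace_inv_mul_sq_le hR hε
  have h3 := trace_mul_re_nonneg hS.inv.posSemidef h
  rw [Matrix.mul_sub, Matrix.trace_sub, Complex.sub_re] at h3
  have h4 : (R + (ε : ℂ) • (1 : Matrix ι ι ℂ)).trace.re = R.trace.re + ε * Fintype.card ι := by
    rw [Matrix.trace_add, Matrix.trace_smul, Matrix.trace_one]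
    simp
  rw [h4] at h1
  unfold traceSqrt
  linarith

/-- The trace norm is at most `(Tr (S⁻¹ X²) + Tr S) / 2`. -/
theorem two_mul_traceNorm_le {X S : Matrix ι ι ℂ} (hX : X.IsHermitian) (hS : S.PosDef) :
    2 * traceNorm X ≤ (S⁻¹ * (X * X)).trace.re + S.trace.re := by
  have h := two_mul_trace_le (Matrix.nonneg_iff_posSemidef.mp (CFC.abs_nonneg X)) hS
  rw [CFC.abs_mul_abs, Matrix.star_eq_conjTranspose, hX.eq] at h
  rwa [traceNorm_eq_trace_abs]

/-- Trace-preserving positive maps contract the trace norm of Hermitian matrices. -/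
theorem traceNorm_map_le {κ : Type} [Fintype κ] [DecidableEq κ]
    {T : Matrix ι ι ℂ →ₗ[ℂ] Matrix κ κ ℂ} (hpos : ∀ X, X.PosSemidef → (T X).PosSemidef)
    (htr : ∀ X, (T X).trace = X.trace) {X : Matrix ι ι ℂ} (hX : X.IsHermitian) :
    traceNorm (T X) ≤ traceNorm X := by
  obtain ⟨P, N, hP, hN, h, hn⟩ := exists_jordan hX
  have := traceNorm_sub_le (hpos P hP) (hpos N hN)
  rwa [htr, htr, ← map_sub, ← h, ← hn] at this

theorem isHermitian_map {κ : Type} [Fintype κ] [DecidableEq κ]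
    {T : Matrix ι ι ℂ →ₗ[ℂ] Matrix κ κ ℂ} (hpos : ∀ X, X.PosSemidef → (T X).PosSemidef)
    {X : Matrix ι ι ℂ} (hX : X.IsHermitian) : (T X).IsHermitian := by
  obtain ⟨P, N, hP, hN, rfl, -⟩ := exists_jordan hX
  rw [map_sub]
  exact (hpos P hP).1.sub (hpos N hN).1

/-- For a pure state `ρ`, the trace distance to `σ` is at least `1 - Tr (ρ σ)`. -/
theorem one_sub_le_traceDist {ρ σ : Matrix ι ι ℂ} (hρ : ρ.PosSemidef) (hρ1 : ρ.trace = 1)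
    (hρ2 : ρ * ρ = ρ) (hσ : σ.PosSemidef) (hσ1 : σ.trace = 1) :
    1 - (ρ * σ).trace.re ≤ traceDist ρ σ := by
  obtain ⟨P, N, hP, hN, h, hn⟩ := exists_jordan (hρ.1.sub hσ.1)
  have hproj : (1 - ρ).PosSemidef := by
    have h1 : (1 - ρ).IsHermitian := Matrix.isHermitian_one.sub hρ.1
    have h2 := Matrix.posSemidef_conjTranspose_mul_self (1 - ρ)
    rw [h1.eq] at h2
    have h3 : (1 - ρ) * (1 - ρ) = 1 - ρ := by
      rw [Matrix.mul_sub, Matrix.sub_mul, Matrix.sub_mul, hρ2]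
      simp
    rwa [h3] at h2
  have h1 := trace_mul_re_nonneg hproj hP
  have h2 := trace_mul_re_nonneg hρ hN
  rw [Matrix.sub_mul, Matrix.trace_sub, Complex.sub_re, Matrix.one_mul] at h1
  -- Equal traces make the trace distance Tr P, while 1 - Tr ρσ = Tr ρ(ρ - σ) ≤ Tr ρP ≤ Tr P.
  have h3 : P.trace.re - N.trace.re = 0 := by
    rw [← Complex.sub_re, ← Matrix.trace_sub, ← h, Matrix.trace_sub, hρ1, hσ1]
    simp
  have h4 : 1 - (ρ * σ).trace.re = (ρ * P).trace.re - (ρ * N).trace.re := by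
    rw [← Complex.sub_re, ← Matrix.trace_sub, ← Matrix.mul_sub, ← h, Matrix.mul_sub, hρ2,
      Matrix.trace_sub, hρ1]
    simp
  rw [traceDist, hn, h4]
  linarith

end TraceNorm

/-! ### Algebra of tensor products of matrices. -/

section TensorProducts

theorem tensorProd_mul {n : ℕ} {ι κ l : Type} [Fintype κ] (A : Fin n → Matrix ι κ ℂ)
    (B : Fin n → Matrix κ l ℂ) :
    tensorProd A * tensorProd B = tensorProd fun k => A k * B k := by
  ext a b
  simp only [tensorProd, Matrix.mul_apply, Matrix.of_apply, ← Finset.prod_mul_distrib]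
  rw [Finset.prod_univ_sum, Fintype.piFinset_univ]

theorem tensorPow_mul (n : ℕ) {ι : Type} [Fintype ι] (A B : Matrix ι ι ℂ) :
    tensorPow n A * tensorPow n B = tensorPow n (A * B) :=
  tensorProd_mul _ _

theorem tensorPow_smul (n : ℕ) {ι κ : Type} (c : ℂ) (A : Matrix ι κ ℂ) :
    tensorPow n (c • A) = c ^ n • tensorPow n A := by
  ext a b
  simp [tensorPow, tensorProd, Finset.prod_mul_distrib]

theorem trace_tensorProd {n : ℕ} {ι : Type} [Fintype ι] (A : Fin n → Matrix ι ι ℂ) :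
    (tensorProd A).trace = ∏ k, (A k).trace := by
  simp only [Matrix.trace, tensorProd, Matrix.diag_apply, Matrix.of_apply]
  rw [Finset.prod_univ_sum, Fintype.piFinset_univ]

theorem conjTranspose_tensorPow (n : ℕ) {ι κ : Type} (A : Matrix ι κ ℂ) :
    (tensorPow n A).conjTranspose = tensorPow n A.conjTranspose := by
  ext a b
  simp [tensorPow, tensorProd]

theorem tensorPow_posSemidef (n : ℕ) {ι : Type} [Fintype ι] [DecidableEq ι] {A : Matrix ι ι ℂ}
    (hA : A.PosSemidef) : (tensorPow n A).PosSemidef := by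
  obtain ⟨B, rfl⟩ := CStarAlgebra.nonneg_iff_eq_star_mul_self.mp hA.nonneg
  rw [Matrix.star_eq_conjTranspose, ← tensorPow_mul, ← conjTranspose_tensorPow]
  exact Matrix.posSemidef_conjTranspose_mul_self _

theorem tensorProd_sum {n : ℕ} {ι κ m : Type} [Fintype m] (A : Fin n → m → Matrix ι κ ℂ) :
    tensorProd (fun k => ∑ x, A k x) = ∑ y : Fin n → m, tensorProd fun k => A k (y k) := by
  classical
  ext a b
  simp only [tensorProd, Matrix.of_apply, Matrix.sum_apply]
  rw [Finset.prod_univ_sum, Fintype.piFinset_univ]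

theorem tensorProd_single {n : ℕ} {ι : Type} [Fintype ι] [DecidableEq ι] (i j : Fin n → ι) :
    tensorProd (fun k => Matrix.single (i k) (j k) (1 : ℂ)) = Matrix.single i j 1 := by
  ext a b
  simp only [tensorProd, Matrix.of_apply, Matrix.single_apply, Finset.prod_ite_zero,
    Finset.prod_const_one, Finset.mem_univ, true_imp_iff, forall_and, funext_iff]

end TensorProducts

/-! ### Choi states and tensor powers of maps. -/

section Channels

variable {ι : Type} [Fintype ι] [DecidableEq ι]

theorem map_eq_sum_single {κ : Type} (T : Matrix ι ι ℂ →ₗ[ℂ] Matrix κ κ ℂ) (X : Matrix ι ι ℂ) :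
    T X = ∑ i, ∑ j, X i j • T (Matrix.single i j 1) := by
  conv_lhs => rw [Matrix.matrix_eq_sum_single X]
  simp only [map_sum]
  refine Finset.sum_congr rfl fun i _ => Finset.sum_congr rfl fun j _ => ?_
  rw [← map_smul, Matrix.smul_single, smul_eq_mul, mul_one]

theorem choiState_apply {κ : Type} (T : Matrix ι ι ℂ →ₗ[ℂ] Matrix κ κ ℂ) (a b : κ) (i j : ι) :
    choiState T (a, i) (b, j) =
      (Fintype.card ι : ℂ)⁻¹ * T (Matrix.single i j 1) a b := by
  have h : (Matrix.of fun k l => Matrix.vecMulVec (maxEntangled ι) (star (maxEntangled ι))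
      (k, i) (l, j)) = (Fintype.card ι : ℂ)⁻¹ • Matrix.single i j (1 : ℂ) := by
    have hc : ((1 / √(Fintype.card ι : ℝ) : ℝ) : ℂ) * ((1 / √(Fintype.card ι : ℝ) : ℝ) : ℂ) =
        (Fintype.card ι : ℂ)⁻¹ := by
      rw [← Complex.ofReal_mul, div_mul_div_comm, Real.mul_self_sqrt (Nat.cast_nonneg _)]
      simp
    ext k l
    simp only [Matrix.vecMulVec, Matrix.of_apply, maxEntangled, Pi.star_apply, Matrix.smul_apply,
      Matrix.single_apply, smul_eq_mul, eq_comm (a := i), eq_comm (a := j)]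
    by_cases hk : k = i <;> by_cases hl : l = j
    · rw [if_pos hk, if_pos hl, if_pos ⟨hk, hl⟩, mul_one, RCLike.star_def, Complex.conj_ofReal, hc]
    · simp [hl]
    · simp [hk]
    · simp [hk]
  simp only [choiState, ampliation, Matrix.of_apply]
  rw [h, map_smul, Matrix.smul_apply, smul_eq_mul]

theorem partialTrace_choiState_sq {κ : Type} [Fintype κ] [DecidableEq κ]
    (T : Matrix ι ι ℂ →ₗ[ℂ] Matrix κ κ ℂ) :
    partialTrace₂ (choiState T ^ 2) = ((Fintype.card ι : ℂ)⁻¹ ^ 2) •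
      ∑ i, ∑ j, T (Matrix.single i j 1) * T (Matrix.single j i 1) := by
  ext a b
  simp only [partialTrace₂, Matrix.of_apply, pow_two (choiState T), Matrix.mul_apply,
    Fintype.sum_prod_type, choiState_apply, Matrix.smul_apply, Matrix.sum_apply, smul_eq_mul,
    Finset.mul_sum]
  refine Finset.sum_congr rfl fun i _ => ?_
  rw [Finset.sum_comm]
  refine Finset.sum_congr rfl fun j _ => Finset.sum_congr rfl fun c _ => ?_
  ring

theorem partialTrace_posSemidef {ι κ : Type} [Fintype ι] [Fintype κ] {X : Matrix (κ × ι) (κ × ι) ℂ}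
    (hX : X.PosSemidef) : (partialTrace₂ X).PosSemidef := by
  have h : partialTrace₂ X = ∑ i, X.submatrix (fun a => (a, i)) (fun a => (a, i)) := by
    ext a b
    simp [partialTrace₂, Matrix.sum_apply]
  rw [h]
  exact Matrix.posSemidef_sum _ fun i _ => hX.submatrix _

/-- Gives the positivity of π as a marginal of the positive matrix τ. -/
theorem partialTrace_choiState {κ : Type} (T : Matrix ι ι ℂ →ₗ[ℂ] Matrix κ κ ℂ) :
    partialTrace₂ (choiState T) = averageOutput T := by
  ext a b
  rw [averageOutput, map_smul, ← Matrix.sum_single_one, map_sum]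
  simp [partialTrace₂, choiState_apply, Matrix.sum_apply, Finset.mul_sum]

theorem channelPow_single (n : ℕ) {κ : Type} (Φ : Matrix ι ι ℂ →ₗ[ℂ] Matrix κ κ ℂ)
    (i j : Fin n → ι) :
    channelPow n Φ (Matrix.single i j 1) = tensorProd fun k => Φ (Matrix.single (i k) (j k) 1) := by
  rw [← tensorProd_single, channelPow_tensorProd]

theorem channelPow_trace (n : ℕ) {κ : Type} [Fintype κ]
    {Φ : Matrix ι ι ℂ →ₗ[ℂ] Matrix κ κ ℂ} (h : ∀ X, (Φ X).trace = X.trace)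
    (X : Matrix (Fin n → ι) (Fin n → ι) ℂ) : (channelPow n Φ X).trace = X.trace := by
  conv_rhs => rw [← LinearMap.id_apply (R := ℂ) X, map_eq_sum_single LinearMap.id X]
  rw [map_eq_sum_single (channelPow n Φ)]
  simp only [Matrix.trace_sum, Matrix.trace_smul, channelPow_single, trace_tensorProd, h,
    LinearMap.id_apply]
  simp only [← trace_tensorProd, tensorProd_single]

/-- `∑ Φ^{⊗ n}(E_{ij}) Φ^{⊗ n}(E_{ji}) = D² (Tr₂ τ²)^{⊗ n}`. -/
theorem sum_channelPow_single_mul (n : ℕ) {κ : Type} [Fintype κ] [DecidableEq κ] [Nonempty ι]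
    (Φ : Matrix ι ι ℂ →ₗ[ℂ] Matrix κ κ ℂ) :
    ∑ i, ∑ j, channelPow n Φ (Matrix.single i j 1) * channelPow n Φ (Matrix.single j i 1) =
      ((Fintype.card ι : ℂ) ^ n) ^ 2 • tensorPow n (partialTrace₂ (choiState Φ ^ 2)) := by
  have hc : (Fintype.card ι : ℂ) ≠ 0 := by exact_mod_cast Fintype.card_ne_zero
  rw [partialTrace_choiState_sq, tensorPow_smul, smul_smul, ← pow_mul, ← pow_mul, mul_comm n 2,
    ← mul_pow, mul_inv_cancel₀ hc, one_pow, one_smul, tensorPow, ← Fintype.sum_prod_type',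
    ← Fintype.sum_prod_type', tensorProd_sum fun _ (p : ι × ι) =>
      Φ (Matrix.single p.1 p.2 1) * Φ (Matrix.single p.2 p.1 1)]
  refine Fintype.sum_equiv (Equiv.arrowProdEquivProdArrow (Fin n) (fun _ => ι) (fun _ => ι)).symm
    _ _ fun p => ?_
  rw [channelPow_single, channelPow_single, tensorProd_mul]
  rfl

theorem channelPow_one (n : ℕ) {κ : Type} [Nonempty ι] (Φ : Matrix ι ι ℂ →ₗ[ℂ] Matrix κ κ ℂ) :
    channelPow n Φ 1 = ((Fintype.card ι : ℂ) ^ n) • tensorPow n (averageOutput Φ) := by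
  have hc : (Fintype.card ι : ℂ) ≠ 0 := by exact_mod_cast Fintype.card_ne_zero
  have h1 : (1 : Matrix (Fin n → ι) (Fin n → ι) ℂ) = tensorProd fun _ => 1 := by
    ext a b
    simp [tensorProd, Matrix.one_apply, Finset.prod_ite_zero, funext_iff]
  rw [h1, channelPow_tensorProd, averageOutput, map_smul, tensorPow_smul, smul_smul, ← mul_pow,
    mul_inv_cancel₀ hc, one_pow, one_smul, tensorPow]

end Channels

/-! ### Kraus operators and positivity of Φ^{⊗n}. -/

section FinChannels

variable {d : ℕ} {Φ : Matrix (Fin d) (Fin d) ℂ →ₗ[ℂ] Matrix (Fin d) (Fin d) ℂ}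

theorem choiState_posSemidef (hΦ : IsCompletelyPositive Φ) : (choiState Φ).PosSemidef :=
  hΦ d _ (Matrix.posSemidef_vecMulVec_self_star _)

theorem partialTrace_choiState_sq_posSemidef (hΦ : IsCompletelyPositive Φ) :
    (partialTrace₂ (choiState Φ ^ 2)).PosSemidef :=
  partialTrace_posSemidef ((choiState_posSemidef hΦ).pow 2)

/-- A Kraus decomposition. -/
theorem exists_kraus (hd : d ≠ 0) (hΦ : IsCompletelyPositive Φ) :
    ∃ K : (Fin d × Fin d) → Matrix (Fin d) (Fin d) ℂ, ∀ i j,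
      Φ (Matrix.single i j 1) =
        (d : ℂ) • ∑ m, K m * Matrix.single i j 1 * (K m).conjTranspose := by
  obtain ⟨C, hC⟩ := CStarAlgebra.nonneg_iff_eq_star_mul_self.mp (choiState_posSemidef hΦ).nonneg
  -- With τ = C†C, each conjugated row of C, reshaped to a matrix, is a Kraus operator; the factor d
  -- undoes the normalisation of Ω.
  refine ⟨fun m => Matrix.of fun a i => star (C m (a, i)), fun i j => ?_⟩
  ext a b
  have h := choiState_apply Φ a b i j
  rw [hC, Fintype.card_fin, Matrix.mul_apply] at h
  have hd' : (d : ℂ) ≠ 0 := by exact_mod_cast hd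
  rw [eq_inv_mul_iff_mul_eq₀ hd'] at h
  rw [← h, Matrix.smul_apply, Matrix.sum_apply, smul_eq_mul]
  congr 1
  refine Finset.sum_congr rfl fun m _ => ?_
  simp [Matrix.mul_apply, Matrix.single_apply, ite_and]

/-- Tensor products of Kraus operators of Φ are Kraus operators of Φ^{⊗n}. Positivity of Φ alone
would not survive tensor powers, so this is where complete positivity is essential. -/
theorem channelPow_posSemidef (hd : d ≠ 0) (n : ℕ) (hΦ : IsCompletelyPositive Φ)
    {X : Matrix (Fin n → Fin d) (Fin n → Fin d) ℂ} (hX : X.PosSemidef) :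
    (channelPow n Φ X).PosSemidef := by
  obtain ⟨K, hK⟩ := exists_kraus hd hΦ
  have h : channelPow n Φ X = ((d : ℂ) ^ n) • ∑ m : Fin n → Fin d × Fin d,
      (tensorProd fun k => K (m k)) * X * (tensorProd fun k => K (m k)).conjTranspose := by
    have hs : ∀ i j, channelPow n Φ (Matrix.single i j 1) =
        ((d : ℂ) ^ n) • ∑ m : Fin n → Fin d × Fin d, (tensorProd fun k => K (m k)) *
          Matrix.single i j 1 * (tensorProd fun k => K (m k)).conjTranspose := by
      intro i j
      have hconj : ∀ m : Fin n → Fin d × Fin d, (tensorProd fun k => K (m k)).conjTranspose =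
          tensorProd fun k => (K (m k)).conjTranspose := fun m => by
        ext a b
        simp [tensorProd]
      simp only [hconj]
      rw [channelPow_single]
      simp only [← tensorProd_single, tensorProd_mul]
      rw [← tensorProd_sum fun k x => K x * Matrix.single (i k) (j k) 1 * (K x).conjTranspose]
      ext a b
      simp only [hK, tensorProd, Matrix.of_apply, Matrix.smul_apply, smul_eq_mul,
        Finset.prod_mul_distrib, Finset.prod_const, Finset.card_univ, Fintype.card_fin]
    -- The Kraus sum is packaged as a linear map so that agreement on matrix units suffices.
    let L : Matrix (Fin n → Fin d) (Fin n → Fin d) ℂ →ₗ[ℂ]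
        Matrix (Fin n → Fin d) (Fin n → Fin d) ℂ :=
      ((d : ℂ) ^ n) • ∑ m : Fin n → Fin d × Fin d,
        LinearMap.mulRight ℂ (tensorProd fun k => K (m k)).conjTranspose ∘ₗ
          LinearMap.mulLeft ℂ (tensorProd fun k => K (m k))
    have hL : ∀ Y, L Y = ((d : ℂ) ^ n) • ∑ m : Fin n → Fin d × Fin d,
        (tensorProd fun k => K (m k)) * Y * (tensorProd fun k => K (m k)).conjTranspose :=
      fun Y => by simp [L]
    rw [← hL, map_eq_sum_single (channelPow n Φ), map_eq_sum_single L]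
    simp only [hs, hL]
  rw [h]
  refine (Matrix.posSemidef_sum _ fun m _ => hX.mul_mul_conjTranspose_same _).smul ?_
  exact pow_nonneg (by exact_mod_cast Nat.zero_le d) n

end FinChannels

/-! ### Fourth moments of a Haar random vector. -/

section Haar

variable {ι : Type} [Fintype ι] [DecidableEq ι]

instance : IsProbabilityMeasure (haarUnitary ι) :=
  ⟨by
    simpa [haarUnitary] using Measure.haarMeasure_self
      (K₀ := (⊤ : TopologicalSpace.PositiveCompacts (Matrix.unitaryGroup ι ℂ)))⟩

instance : Measure.IsMulLeftInvariant (haarUnitary ι) := by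
  unfold haarUnitary
  infer_instance

theorem integrable_of_continuous_unitary (μ : Measure (Matrix.unitaryGroup ι ℂ))
    [IsFiniteMeasure μ] {f : Matrix.unitaryGroup ι ℂ → ℂ} (hf : Continuous f) :
    Integrable f μ :=
  hf.integrable_of_hasCompactSupport (HasCompactSupport.of_compactSpace f)

/-- The Haar average of continuous functions, as a linear functional. -/
noncomputable def haarAverage (ι : Type) [Fintype ι] [DecidableEq ι] :
    C(Matrix.unitaryGroup ι ℂ, ℂ) →ₗ[ℂ] ℂ where
  toFun f := ∫ U, f U ∂(haarUnitary ι)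
  map_add' f g := integral_add (integrable_of_continuous_unitary _ f.continuous)
    (integrable_of_continuous_unitary _ g.continuous)
  map_smul' c _ := integral_const_mul c _

theorem haarAverage_apply (f : C(Matrix.unitaryGroup ι ℂ, ℂ)) :
    haarAverage ι f = ∫ U, f U ∂(haarUnitary ι) := rfl

/-- The `i`-th coordinate of `U φ`. -/
noncomputable def orbitCoord (φ : ι → ℂ) (i : ι) : C(Matrix.unitaryGroup ι ℂ, ℂ) where
  toFun U := ((U : Matrix ι ι ℂ).mulVec φ) i
  continuous_toFun := by
    simp only [Matrix.mulVec, dotProduct]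
    refine continuous_finsetSum _ fun j _ => Continuous.mul ?_ continuous_const
    exact (continuous_subtype_val.matrix_elem i j)

/-- The fourth moments of the coordinates of a Haar random vector. -/
noncomputable def haarMoment (φ : ι → ℂ) (i j k l : ι) : ℂ :=
  haarAverage ι (orbitCoord φ i * star (orbitCoord φ j) *
    (orbitCoord φ k * star (orbitCoord φ l)))

/-- Left invariance of Haar measure under U ↦ VU. The family `x` stands for the coordinates of VUφ,
so that each application can supply them already expanded. -/
theorem haarMoment_invariant (φ : ι → ℂ) (V : Matrix.unitaryGroup ι ℂ) (i j k l : ι)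
    (x : ι → C(Matrix.unitaryGroup ι ℂ, ℂ))
    (hx : ∀ p U, x p U = ((V : Matrix ι ι ℂ).mulVec ((U : Matrix ι ι ℂ).mulVec φ)) p) :
    haarAverage ι (x i * star (x j) * (x k * star (x l))) = haarMoment φ i j k l := by
  have h := integral_mul_left_eq_self (μ := haarUnitary ι) (⇑(orbitCoord φ i *
    star (orbitCoord φ j) * (orbitCoord φ k * star (orbitCoord φ l)))) V
  rw [haarMoment, haarAverage_apply, haarAverage_apply, ← h]
  refine integral_congr_ae (Filter.Eventually.of_forall fun U => ?_)
  simp [hx, orbitCoord, Matrix.mulVec_mulVec]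

/-- The phase is I rather than -1 because a coordinate may occur twice unconjugated: I² = -1 still
detects this, whereas (-1)² = 1 would not. -/
theorem haarMoment_phase (φ : ι → ℂ) (p i j k l : ι) (c : ι → ℂ)
    (hc : ∀ q, c q = if q = p then Complex.I else 1) :
    c i * star (c j) * (c k * star (c l)) * haarMoment φ i j k l = haarMoment φ i j k l := by
  have hV : Matrix.diagonal c ∈ Matrix.unitaryGroup ι ℂ := by
    rw [Matrix.mem_unitaryGroup_iff, Matrix.star_eq_conjTranspose, Matrix.diagonal_conjTranspose,
      Matrix.diagonal_mul_diagonal, ← Matrix.diagonal_one]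
    congr 1
    ext q
    rw [Pi.star_apply, hc]
    split_ifs <;> simp
  have h := haarMoment_invariant φ ⟨_, hV⟩ i j k l (fun q => c q • orbitCoord φ q) fun q U => by
    simp [orbitCoord, Matrix.mulVec_diagonal]
  conv_rhs => rw [← h]
  rw [haarMoment, ← smul_eq_mul, ← map_smul]
  congr 1
  ext U
  simp
  ring

theorem haarMoment_eq_zero (φ : ι → ℂ) {i j k l : ι}
    (h : ¬((i = j ∧ k = l) ∨ (i = l ∧ k = j))) : haarMoment φ i j k l = 0 := by
  have key : ∀ p, (fun c : ι → ℂ => c i * star (c j) * (c k * star (c l)))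
      (fun q => if q = p then Complex.I else 1) ≠ 1 → haarMoment φ i j k l = 0 := by
    intro p hp
    have h1 := haarMoment_phase φ p i j k l (fun q => if q = p then Complex.I else 1) fun _ => rfl
    by_contra h0
    exact hp (mul_right_cancel₀ h0 (h1.trans (one_mul _).symm))
  by_cases hij : i = j
  · subst hij
    have hkl : k ≠ l := fun e => h (Or.inl ⟨rfl, e⟩)
    refine key k ?_
    by_cases hik : i = k <;> simp [hik, hkl.symm, Complex.ext_iff]
  · by_cases hil : i = l
    · subst hil
      have hkj : k ≠ j := fun e => h (Or.inr ⟨rfl, e⟩)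
      refine key k ?_
      by_cases hik : i = k <;> simp [hik, hkj.symm, Complex.ext_iff]
    · refine key i ?_
      by_cases hik : k = i <;> norm_num [hik, Ne.symm hij, Ne.symm hil, Complex.ext_iff]

theorem haarMoment_swap (φ : ι → ℂ) (i j k l : ι) :
    haarMoment φ i j k l = haarMoment φ i l k j := by
  unfold haarMoment
  congr 1
  ring

theorem haarMoment_comm (φ : ι → ℂ) (i j k l : ι) :
    haarMoment φ i j k l = haarMoment φ k l i j := by
  unfold haarMoment
  congr 1
  ring

/-- Invariance of the fourth moments under the reflection with rows `(3, 4) / 5, (4, -3) / 5`. -/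
theorem haarMoment_reflection (φ : ι → ℂ) {i k : ι} (hik : i ≠ k) :
    625 * haarMoment φ i i i i =
      81 * haarMoment φ i i i i + 256 * haarMoment φ k k k k + 576 * haarMoment φ i i k k := by
  -- V is the Householder reflection along v = e_i - 2e_k. Since v·v = 5, its entries are rational,
  -- and (Vw)_i = (3w_i + 4w_k)/5.
  set v : ι → ℂ := Pi.single i 1 - (2 : ℂ) • Pi.single k 1 with hv
  set V : Matrix ι ι ℂ := 1 - (2 / 5 : ℂ) • Matrix.vecMulVec v v with hVdef
  have hvi : v i = 1 := by simp [hv, hik]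
  have hvs : star v = v := by
    ext q
    simp only [hv, Pi.star_apply, Pi.sub_apply, Pi.smul_apply, Pi.single_apply]
    split_ifs <;> simp
  have hvv : v ⬝ᵥ v = 5 := by
    simp only [hv, sub_dotProduct, dotProduct_sub, smul_dotProduct, dotProduct_smul]
    simp [hik, hik.symm]
    norm_num
  have hVs : star V = V := by
    rw [hVdef, star_sub, star_one, star_smul, Matrix.star_eq_conjTranspose,
      Matrix.conjTranspose_vecMulVec, hvs]
    simp
  have hV : V ∈ Matrix.unitaryGroup ι ℂ := by
    rw [Matrix.mem_unitaryGroup_iff, hVs, hVdef, Matrix.mul_sub, Matrix.sub_mul, Matrix.sub_mul]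
    simp only [Matrix.smul_mul, Matrix.mul_smul, Matrix.vecMulVec_mul_vecMulVec, hvv,
      Matrix.one_mul, Matrix.mul_one, Matrix.vecMulVec_smul]
    module
  set a := orbitCoord φ i
  set b := orbitCoord φ k
  have h := haarMoment_invariant φ ⟨V, hV⟩ i i i i
    (fun q => orbitCoord φ q - ((2 / 5 : ℂ) * v q) • (a - (2 : ℂ) • b)) fun q U => by
      change (U : Matrix ι ι ℂ).mulVec φ q - 2 / 5 * v q *
        ((U : Matrix ι ι ℂ).mulVec φ i - 2 * (U : Matrix ι ι ℂ).mulVec φ k) =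
          (V.mulVec ((U : Matrix ι ι ℂ).mulVec φ)) q
      rw [hVdef, Matrix.sub_mulVec, Matrix.smul_mulVec, Matrix.vecMulVec_mulVec, Matrix.one_mulVec]
      have hdot : ∀ w : ι → ℂ, v ⬝ᵥ w = w i - 2 * w k := fun w => by
        rw [hv, sub_dotProduct, smul_dotProduct]
        simp
      simp [hdot]
      ring
  have hexp : (625 : ℂ) • ((a - ((2 / 5 : ℂ) * v i) • (a - (2 : ℂ) • b)) *
      star (a - ((2 / 5 : ℂ) * v i) • (a - (2 : ℂ) • b)) *
      ((a - ((2 / 5 : ℂ) * v i) • (a - (2 : ℂ) • b)) *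
      star (a - ((2 / 5 : ℂ) * v i) • (a - (2 : ℂ) • b)))) =
      (81 : ℂ) • (a * star a * (a * star a)) + (256 : ℂ) • (b * star b * (b * star b))
      + (288 : ℂ) • (a * star a * (b * star b)) + (288 : ℂ) • (a * star b * (b * star a))
      + (144 : ℂ) • (a * star b * (a * star b)) + (144 : ℂ) • (b * star a * (b * star a))
      + (216 : ℂ) • (a * star a * (a * star b)) + (216 : ℂ) • (a * star a * (b * star a))
      + (384 : ℂ) • (b * star b * (a * star b)) + (384 : ℂ) • (b * star b * (b * star a)) := by
    ext U
    simp [hvi]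
    ring
  have h' := congrArg (haarAverage ι) hexp
  simp only [map_add, map_smul, smul_eq_mul] at h'
  simp only [← haarMoment.eq_1, a, b] at h' h
  -- Only paired terms survive; the two mixed ones agree by the swap symmetry, giving 288 + 288 =
  -- 576.
  rw [h, haarMoment_swap φ i k k i, haarMoment_eq_zero φ (i := i) (j := k) (k := i) (l := k),
    haarMoment_eq_zero φ (i := k) (j := i) (k := k) (l := i),
    haarMoment_eq_zero φ (i := i) (j := i) (k := i) (l := k),
    haarMoment_eq_zero φ (i := i) (j := i) (k := k) (l := i),
    haarMoment_eq_zero φ (i := k) (j := k) (k := i) (l := k),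
    haarMoment_eq_zero φ (i := k) (j := k) (k := k) (l := i)] at h'
  · linear_combination h'
  all_goals simp [hik, hik.symm]

theorem haarMoment_diag (φ : ι → ℂ) {i k : ι} (hik : i ≠ k) :
    haarMoment φ i i i i = haarMoment φ k k k k ∧
      haarMoment φ i i i i = 2 * haarMoment φ i i k k := by
  have h1 := haarMoment_reflection φ hik
  have h2 := haarMoment_reflection φ hik.symm
  rw [haarMoment_comm φ k k i i] at h2
  constructor
  · linear_combination (1 / 800) * h1 - (1 / 800) * h2
  · linear_combination (1 / 288) * h1 + (256 / 288) * ((-1 / 800) * h1 + (1 / 800) * h2)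

theorem haarMoment_eq (φ : EuclideanSpace ℂ ι) (hφ : ‖φ‖ = 1) (i j k l : ι) :
    haarMoment φ i j k l = ((if i = j ∧ k = l then 1 else 0) + if i = l ∧ k = j then 1 else 0) /
      ((Fintype.card ι : ℂ) * (Fintype.card ι + 1)) := by
  set c := haarMoment φ i i i i / 2 with hc
  have hdiag : ∀ p, haarMoment φ p p p p = 2 * c := fun p => by
    by_cases hp : p = i
    · rw [hp, hc]; ring
    · rw [(haarMoment_diag φ hp).1, hc]; ring
  have hall : ∀ i j k l, haarMoment φ i j k l =
      c * ((if i = j ∧ k = l then 1 else 0) + if i = l ∧ k = j then 1 else 0) := by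
    intro i j k l
    by_cases h : (i = j ∧ k = l) ∨ (i = l ∧ k = j)
    · by_cases hik : i = k
      · have : j = i ∧ l = i := by subst hik; tauto
        obtain ⟨rfl, rfl⟩ := this
        subst hik
        simp [hdiag]; ring
      · rcases h with ⟨rfl, rfl⟩ | ⟨rfl, rfl⟩
        · have := (haarMoment_diag φ hik).2
          rw [hdiag] at this
          simp [hik]
          linear_combination (-1 / 2) * this
        · have := (haarMoment_diag φ hik).2
          rw [hdiag] at this
          rw [haarMoment_swap]
          simp [hik]
          linear_combination (-1 / 2) * this
    · rw [haarMoment_eq_zero φ h]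
      push Not at h
      rw [if_neg (fun e => h.1 e.1 e.2), if_neg (fun e => h.2 e.1 e.2)]
      simp
  -- Since Uφ is a unit vector, this sum is the average of ‖Uφ‖⁴. Its D² terms equal c, plus a
  -- further c on the diagonal, which determines c.
  have hsum : ∑ p, ∑ q, haarMoment φ p p q q = 1 := by
    have h1 : ∑ p, orbitCoord (φ : ι → ℂ) p * star (orbitCoord (φ : ι → ℂ) p) = 1 := by
      ext U
      have htr := (conjState U (pureState φ hφ)).2.2
      simp only [conjState, pureState, Matrix.mul_vecMulVec, Matrix.vecMulVec_mul,
        Matrix.trace_vecMulVec] at htr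
      rw [Matrix.star_eq_conjTranspose, ← Matrix.star_mulVec] at htr
      simpa [orbitCoord, dotProduct, ContinuousMap.sum_apply] using htr
    unfold haarMoment
    simp only [← map_sum, ← Finset.mul_sum, ← Finset.sum_mul, h1]
    simp [haarAverage_apply]
  have hD : (Fintype.card ι : ℂ) * (Fintype.card ι + 1) * c = 1 := by
    have h : ∑ p : ι, ∑ q : ι, c * (1 + if p = q then 1 else 0) = 1 :=
      (Finset.sum_congr rfl fun p _ => Finset.sum_congr rfl fun q _ => by
        rw [hall]
        by_cases h : p = q <;> simp [h, eq_comm]).trans hsum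
    simp only [mul_add, mul_one, mul_ite, mul_zero, Finset.sum_add_distrib, Finset.sum_const,
      Finset.card_univ, nsmul_eq_mul, Finset.sum_ite_eq, Finset.mem_univ, if_true] at h
    linear_combination h
  have hD0 : (Fintype.card ι : ℂ) * (Fintype.card ι + 1) ≠ 0 := left_ne_zero_of_mul_eq_one hD
  rw [hall, eq_div_iff hD0]
  linear_combination ((if i = j ∧ k = l then 1 else 0) + if i = l ∧ k = j then 1 else 0) * hD

end Haar

/-! ### Degree bookkeeping for polynomials in U and U†. -/

section Bidegree

variable {ι : Type} [Fintype ι]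

/-- The polynomial has degree at most `s` in the entries of `U` and at most `t` in those of `U†`. -/
def BidegreeLE (s t : ℕ) (P : MvPolynomial ((ι × ι) ⊕ (ι × ι)) ℂ) : Prop :=
  ∀ m ∈ P.support, ∑ p : ι × ι, m (Sum.inl p) ≤ s ∧ ∑ p : ι × ι, m (Sum.inr p) ≤ t

theorem BidegreeLE.mul {s t s' t' : ℕ} {P Q : MvPolynomial ((ι × ι) ⊕ (ι × ι)) ℂ}
    (hP : BidegreeLE s t P) (hQ : BidegreeLE s' t' Q) : BidegreeLE (s + s') (t + t') (P * Q) := by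
  classical
  intro m hm
  obtain ⟨x, hx, y, hy, rfl⟩ := Finset.mem_add.mp (MvPolynomial.support_mul P Q hm)
  simp only [Finsupp.add_apply, Finset.sum_add_distrib]
  exact ⟨add_le_add (hP x hx).1 (hQ y hy).1, add_le_add (hP x hx).2 (hQ y hy).2⟩

theorem BidegreeLE.sum {α : Type} {s t : ℕ} (A : Finset α)
    {P : α → MvPolynomial ((ι × ι) ⊕ (ι × ι)) ℂ} (hP : ∀ a ∈ A, BidegreeLE s t (P a)) :
    BidegreeLE s t (∑ a ∈ A, P a) := by
  classical
  intro m hm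
  obtain ⟨a, ha, hma⟩ := Finset.mem_biUnion.mp (MvPolynomial.support_sum hm)
  exact hP a ha m hma

theorem bidegreeLE_inl (c : ℂ) (p : ι × ι) :
    BidegreeLE 1 0 (MvPolynomial.monomial (Finsupp.single (Sum.inl p) 1) c) := by
  classical
  intro m hm
  obtain rfl := Finset.mem_singleton.mp (MvPolynomial.support_monomial_subset hm)
  simp [Finsupp.single_apply]

theorem bidegreeLE_inr (c : ℂ) (p : ι × ι) :
    BidegreeLE 0 1 (MvPolynomial.monomial (Finsupp.single (Sum.inr p) 1) c) := by
  classical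
  intro m hm
  obtain rfl := Finset.mem_singleton.mp (MvPolynomial.support_monomial_subset hm)
  simp [Finsupp.single_apply]

end Bidegree

section Topology

instance {ι : Type} [Fintype ι] : SecondCountableTopology (Matrix ι ι ℂ) :=
  inferInstanceAs (SecondCountableTopology (ι → ι → ℂ))

instance {ι : Type} [Fintype ι] : SecondCountableTopology (QState ι) :=
  TopologicalSpace.Subtype.secondCountableTopology {ρ : Matrix ι ι ℂ | ρ.PosSemidef ∧ ρ.trace = 1}

@[fun_prop]
theorem continuous_entry {ι : Type} [Fintype ι] (i j : ι) :
    Continuous fun ρ : QState ι => ρ.1 i j :=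
  continuous_subtype_val.matrix_elem i j

end Topology

/-! ### Moments of state designs. -/

section Designs

variable {ι : Type} [Fintype ι] [DecidableEq ι]

theorem continuous_conjState (ρ : QState ι) :
    Continuous fun U : Matrix.unitaryGroup ι ℂ => conjState U ρ := by
  refine Continuous.subtype_mk ?_ _
  fun_prop

theorem conjState_pureState_apply (φ : EuclideanSpace ℂ ι) (hφ : ‖φ‖ = 1)
    (U : Matrix.unitaryGroup ι ℂ) (i j : ι) :
    (conjState U (pureState φ hφ)).1 i j = orbitCoord φ i U * star (orbitCoord φ j U) := by
  simp only [conjState, pureState, Matrix.mul_vecMulVec, Matrix.vecMulVec_mul]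
  rw [Matrix.star_eq_conjTranspose, ← Matrix.star_mulVec]
  rfl

theorem conjState_pureState_mul_self (φ : EuclideanSpace ℂ ι) (hφ : ‖φ‖ = 1)
    (U : Matrix.unitaryGroup ι ℂ) :
    (conjState U (pureState φ hφ)).1 * (conjState U (pureState φ hφ)).1 =
      (conjState U (pureState φ hφ)).1 := by
  have h := (conjState U (pureState φ hφ)).2.2
  simp only [conjState, pureState, Matrix.mul_vecMulVec, Matrix.vecMulVec_mul,
    Matrix.trace_vecMulVec] at h ⊢
  rw [Matrix.vecMulVec_mulVec, dotProduct_comm, h]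
  simp

theorem IsUnitaryDesign.moment {μ : Measure (Matrix.unitaryGroup ι ℂ)} (hμ : IsUnitaryDesign 2 μ)
    (φ : ι → ℂ) (i j k l : ι) :
    ∫ U, orbitCoord φ i U * star (orbitCoord φ j U) *
      (orbitCoord φ k U * star (orbitCoord φ l U)) ∂μ = haarMoment φ i j k l := by
  let P : ι → MvPolynomial ((ι × ι) ⊕ (ι × ι)) ℂ := fun i =>
    ∑ a, MvPolynomial.monomial (Finsupp.single (Sum.inl (i, a)) 1) (φ a)
  let Q : ι → MvPolynomial ((ι × ι) ⊕ (ι × ι)) ℂ := fun j =>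
    ∑ a, MvPolynomial.monomial (Finsupp.single (Sum.inr (a, j)) 1) (star (φ a))
  have hP : ∀ i, BidegreeLE 1 0 (P i) := fun i => BidegreeLE.sum _ fun a _ => bidegreeLE_inl _ _
  have hQ : ∀ i, BidegreeLE 0 1 (Q i) := fun i => BidegreeLE.sum _ fun a _ => bidegreeLE_inr _ _
  -- Coordinates of Uφ are linear in U and their conjugates linear in U†; the degrees add up to (2,
  -- 2) by computation, which is `HasBidegreeLE 2`.
  have h := hμ.average (P i * Q j * (P k * Q l)) (((hP i).mul (hQ j)).mul ((hP k).mul (hQ l)))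
  have hPe : ∀ i U, evalUnitary (P i) U = orbitCoord φ i U := fun i U => by
    simp [evalUnitary, P, orbitCoord, Matrix.mulVec, dotProduct, MvPolynomial.eval_monomial,
      mul_comm]
  have hQe : ∀ i U, evalUnitary (Q i) U = star (orbitCoord φ i U) := fun i U => by
    simp [evalUnitary, Q, orbitCoord, Matrix.mulVec, dotProduct, MvPolynomial.eval_monomial,
      mul_comm]
  have hmul : ∀ A B U, evalUnitary (ι := ι) (A * B) U = evalUnitary A U * evalUnitary B U :=
    fun A B U => map_mul _ _ _
  simp only [hmul, hPe, hQe] at h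
  rw [h, haarMoment, haarAverage_apply]
  rfl

instance : SecondCountableTopology (Matrix.unitaryGroup ι ℂ) :=
  TopologicalSpace.Subtype.secondCountableTopology {U : Matrix ι ι ℂ | U ∈ Matrix.unitaryGroup ι ℂ}

variable {ν : Measure (QState ι)}

theorem IsStateDesign.isProbabilityMeasure {t : ℕ} (hν : IsStateDesign t ν) :
    IsProbabilityMeasure ν := by
  obtain ⟨φ, hφ, μ, hμ, rfl⟩ := hν
  have := hμ.isProbabilityMeasure
  exact Measure.isProbabilityMeasure_map (measurable_conjState _).aemeasurable

theorem IsStateDesign.pure {t : ℕ} (hν : IsStateDesign t ν) : ∀ᵐ ρ ∂ν, ρ.1 * ρ.1 = ρ.1 := by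
  obtain ⟨φ, hφ, μ, hμ, rfl⟩ := hν
  refine (ae_map_iff (measurable_conjState _).aemeasurable ?_).mpr
    (Filter.Eventually.of_forall fun U => conjState_pureState_mul_self φ hφ U)
  exact (isClosed_eq (by fun_prop) (by fun_prop)).measurableSet

theorem IsStateDesign.moment (hν : IsStateDesign 2 ν) (i j k l : ι) :
    ∫ ρ, ρ.1 i j * ρ.1 k l ∂ν =
      ((if i = j ∧ k = l then 1 else 0) + if i = l ∧ k = j then 1 else 0) /
      ((Fintype.card ι : ℂ) * (Fintype.card ι + 1)) := by
  obtain ⟨φ, hφ, μ, hμ, rfl⟩ := hν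
  rw [integral_map (measurable_conjState _).aemeasurable, ← haarMoment_eq φ hφ, ← hμ.moment]
  · simp only [conjState_pureState_apply]
  · exact Continuous.aestronglyMeasurable (by fun_prop)

/-- Integrability is pulled back to the compact product of unitary groups carrying the design. -/
theorem IsStateDesign.integrable_prod {t : ℕ} (hν : IsStateDesign t ν) {E : Type}
    [NormedAddCommGroup E] {f : QState ι × QState ι → E} (hf : Continuous f) :
    Integrable f (ν.prod ν) := by
  obtain ⟨φ, hφ, μ, hμ, rfl⟩ := hν
  have := hμ.isProbabilityMeasure
  rw [Measure.map_prod_map _ _ (measurable_conjState _) (measurable_conjState _),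
    integrable_map_measure hf.aestronglyMeasurable
      ((measurable_conjState _).prodMap (measurable_conjState _)).aemeasurable]
  · refine Continuous.integrable_of_hasCompactSupport ?_ (HasCompactSupport.of_compactSpace _)
    exact hf.comp ((continuous_conjState _).prodMap (continuous_conjState _))
theorem IsStateDesign.integrable {t : ℕ} (hν : IsStateDesign t ν) {E : Type}
    [NormedAddCommGroup E] {f : QState ι → E} (hf : Continuous f) : Integrable f ν := by
  have := hν.isProbabilityMeasure
  have h := hν.integrable_prod (hf.comp continuous_fst)
  exact (measurePreserving_fst (μ := ν) (ν := ν)).integrable_comp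
    hf.aestronglyMeasurable |>.mp h

/-- Inserting Tr ρ = 1 as a second factor reduces this to second moments. -/
theorem IsStateDesign.first_moment (hν : IsStateDesign 2 ν) (i j : ι) :
    ∫ ρ, ρ.1 i j ∂ν = (if i = j then 1 else 0) / (Fintype.card ι : ℂ) := by
  have h : ∀ ρ : QState ι, ρ.1 i j = ∑ k, ρ.1 i j * ρ.1 k k := fun ρ => by
    rw [← Finset.mul_sum]
    have := ρ.2.2
    rw [Matrix.trace] at this
    simp only [Matrix.diag_apply] at this
    rw [this, mul_one]
  have hD : (Fintype.card ι : ℂ) + 1 ≠ 0 := Nat.cast_add_one_ne_zero _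
  have hint : ∀ k, Integrable (fun ρ : QState ι => ρ.1 i j * ρ.1 k k) ν := fun k =>
    hν.integrable ((continuous_entry i j).mul (continuous_entry k k))
  rw [integral_congr_ae (Filter.Eventually.of_forall h),
    integral_finsetSum Finset.univ fun k _ => hint k]
  have hmom : ∀ k, ∫ ρ : QState ι, ρ.1 i j * ρ.1 k k ∂ν =
      ((if i = j then 1 else 0) + if i = k then (if i = j then 1 else 0) else 0) /
      ((Fintype.card ι : ℂ) * (Fintype.card ι + 1)) := fun k => by
    rw [hν.moment]
    by_cases h1 : i = k
    · subst h1; simp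
    · simp [h1]
  simp only [hmom, ← Finset.sum_div, Finset.sum_add_distrib, Finset.sum_const,
    Finset.card_univ, nsmul_eq_mul, Finset.sum_ite_eq, Finset.mem_univ, if_true]
  by_cases hD0 : (Fintype.card ι : ℂ) = 0
  · simp [hD0]
  · field_simp

end Designs

/-- The difference of two states. -/
def stateDiff {ι : Type} [Fintype ι] (p : QState ι × QState ι) : Matrix ι ι ℂ := p.1.1 - p.2.1

theorem isHermitian_stateDiff {ι : Type} [Fintype ι] (p : QState ι × QState ι) :
    (stateDiff p).IsHermitian :=
  p.1.2.1.1.sub p.2.2.1.1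

theorem continuous_stateDiff {ι : Type} [Fintype ι] :
    Continuous (stateDiff : QState ι × QState ι → Matrix ι ι ℂ) :=
  (continuous_subtype_val.comp continuous_fst).sub (continuous_subtype_val.comp continuous_snd)

theorem continuous_map_stateDiff {ι κ : Type} [Fintype ι] (T : Matrix ι ι ℂ →ₗ[ℂ] Matrix κ κ ℂ) :
    Continuous fun p : QState ι × QState ι => T (stateDiff p) :=
  (LinearMap.continuous_of_finiteDimensional T).comp continuous_stateDiff

/-! ### Second moment of the output difference and Jensen's inequality. -/

section SecondMoment

variable {ι : Type} [Fintype ι] [DecidableEq ι] {ν : Measure (QState ι)}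

theorem IsStateDesign.integral_fst_mul_snd (hν : IsStateDesign 2 ν) (i j k l : ι) :
    ∫ p : QState ι × QState ι, p.1.1 i j * p.2.1 k l ∂(ν.prod ν) =
      (if i = j then 1 else 0) / (Fintype.card ι : ℂ) *
        ((if k = l then 1 else 0) / (Fintype.card ι : ℂ)) := by
  have := hν.isProbabilityMeasure
  rw [integral_prod_mul (fun ρ : QState ι => ρ.1 i j) (fun ρ : QState ι => ρ.1 k l),
    hν.first_moment, hν.first_moment]

/-- The identity part combines as 1/(D(D+1)) - 1/D² = -1/(D²(D+1)), the second term coming from the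
independent cross terms; the swap part has no such correction. -/
theorem IsStateDesign.integral_stateDiff_mul [Nonempty ι] (hν : IsStateDesign 2 ν) (i j k l : ι) :
    ∫ p, stateDiff p i j * stateDiff p k l ∂(ν.prod ν) =
      2 / ((Fintype.card ι : ℂ) * (Fintype.card ι + 1)) *
        ((if i = l ∧ k = j then 1 else 0) -
          (if i = j ∧ k = l then 1 else 0) / (Fintype.card ι : ℂ)) := by
  have := hν.isProbabilityMeasure
  have hD : (Fintype.card ι : ℂ) ≠ 0 := by exact_mod_cast Fintype.card_ne_zero
  have hD1 : (Fintype.card ι : ℂ) + 1 ≠ 0 := Nat.cast_add_one_ne_zero _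
  have c1 : ∀ a b, Continuous fun p : QState ι × QState ι => p.1.1 a b := fun a b =>
    (continuous_entry a b).comp continuous_fst
  have c2 : ∀ a b, Continuous fun p : QState ι × QState ι => p.2.1 a b := fun a b =>
    (continuous_entry a b).comp continuous_snd
  have hexp : ∀ p : QState ι × QState ι, stateDiff p i j * stateDiff p k l =
      (p.1.1 i j * p.1.1 k l + p.2.1 i j * p.2.1 k l) -
        (p.1.1 i j * p.2.1 k l + p.1.1 k l * p.2.1 i j) := fun p => by
    simp only [stateDiff, Matrix.sub_apply]
    ring
  have e1 : ∫ p : QState ι × QState ι, p.1.1 i j * p.1.1 k l ∂(ν.prod ν) =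
      ∫ ρ : QState ι, ρ.1 i j * ρ.1 k l ∂ν := by
    rw [integral_fun_fst (fun ρ : QState ι => ρ.1 i j * ρ.1 k l)]
    simp
  have e2 : ∫ p : QState ι × QState ι, p.2.1 i j * p.2.1 k l ∂(ν.prod ν) =
      ∫ ρ : QState ι, ρ.1 i j * ρ.1 k l ∂ν := by
    rw [integral_fun_snd (fun ρ : QState ι => ρ.1 i j * ρ.1 k l)]
    simp
  have i1 : Integrable (fun p : QState ι × QState ι => p.1.1 i j * p.1.1 k l) (ν.prod ν) :=
    hν.integrable_prod ((c1 i j).mul (c1 k l))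
  have i2 : Integrable (fun p : QState ι × QState ι => p.2.1 i j * p.2.1 k l) (ν.prod ν) :=
    hν.integrable_prod ((c2 i j).mul (c2 k l))
  have i3 : Integrable (fun p : QState ι × QState ι => p.1.1 i j * p.2.1 k l) (ν.prod ν) :=
    hν.integrable_prod ((c1 i j).mul (c2 k l))
  have i4 : Integrable (fun p : QState ι × QState ι => p.1.1 k l * p.2.1 i j) (ν.prod ν) :=
    hν.integrable_prod ((c1 k l).mul (c2 i j))
  have i12 : Integrable (fun p : QState ι × QState ι =>
      p.1.1 i j * p.1.1 k l + p.2.1 i j * p.2.1 k l) (ν.prod ν) := i1.add i2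
  have i34 : Integrable (fun p : QState ι × QState ι =>
      p.1.1 i j * p.2.1 k l + p.1.1 k l * p.2.1 i j) (ν.prod ν) := i3.add i4
  rw [integral_congr_ae (Filter.Eventually.of_forall hexp), integral_sub i12 i34,
    integral_add i1 i2, integral_add i3 i4, e1, e2, hν.moment, hν.integral_fst_mul_snd,
    hν.integral_fst_mul_snd]
  have hand : (if i = j ∧ k = l then 1 else 0 : ℂ) =
      (if i = j then 1 else 0) * (if k = l then 1 else 0) := by
    by_cases h1 : i = j <;> by_cases h2 : k = l <;> simp [h1, h2]
  rw [hand]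
  field_simp
  ring

variable {κ : Type} [Fintype κ]

/-- The average of `T(ρ - σ)²` over independent samples `ρ, σ` of a `2`-design. -/
noncomputable def secondMoment (T : Matrix ι ι ℂ →ₗ[ℂ] Matrix κ κ ℂ) : Matrix κ κ ℂ :=
  (2 / ((Fintype.card ι : ℂ) * (Fintype.card ι + 1))) •
    (∑ i, ∑ j, T (Matrix.single i j 1) * T (Matrix.single j i 1) -
      (Fintype.card ι : ℂ)⁻¹ • (T 1 * T 1))

/-- After expansion in matrix units, the pairing i = l, j = k leaves ∑ T(E_ij) T(E_ji), and the
pairing i = j, k = l leaves T(1)². -/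
theorem IsStateDesign.integral_map_sq_apply [Nonempty ι] (hν : IsStateDesign 2 ν)
    (T : Matrix ι ι ℂ →ₗ[ℂ] Matrix κ κ ℂ) (a b : κ) :
    ∫ p, (T (stateDiff p) * T (stateDiff p)) a b ∂(ν.prod ν) = secondMoment T a b := by
  have hexp : ∀ p : QState ι × QState ι, (T (stateDiff p) * T (stateDiff p)) a b =
      ∑ i, ∑ j, ∑ k, ∑ l, stateDiff p i j * stateDiff p k l *
        (T (Matrix.single i j 1) * T (Matrix.single k l 1)) a b := fun p => by
    conv_lhs => rw [map_eq_sum_single T (stateDiff p)]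
    simp only [Matrix.sum_mul]
    simp only [Matrix.mul_sum, Matrix.smul_mul, Matrix.mul_smul, Matrix.sum_apply,
      Matrix.smul_apply, smul_eq_mul]
    refine Finset.sum_congr rfl fun i _ => Finset.sum_congr rfl fun j _ =>
      Finset.sum_congr rfl fun k _ => Finset.sum_congr rfl fun l _ => ?_
    ring
  have hint : ∀ i j k l, Integrable (fun p : QState ι × QState ι =>
      stateDiff p i j * stateDiff p k l *
        (T (Matrix.single i j 1) * T (Matrix.single k l 1)) a b) (ν.prod ν) := fun i j k l =>
    hν.integrable_prod (((continuous_stateDiff.matrix_elem i j).mul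
      (continuous_stateDiff.matrix_elem k l)).mul continuous_const)
  have hone : T 1 = ∑ i, T (Matrix.single i i 1) := by
    rw [← Matrix.sum_single_one, map_sum]
  rw [integral_congr_ae (Filter.Eventually.of_forall hexp),
    integral_finsetSum _ fun i _ => integrable_finsetSum _ fun j _ => integrable_finsetSum _
      fun k _ => integrable_finsetSum _ fun l _ => hint i j k l]
  simp_rw [fun i => integral_finsetSum Finset.univ fun j _ => integrable_finsetSum Finset.univ
      fun k _ => integrable_finsetSum Finset.univ fun l _ => hint i j k l,
    fun i j => integral_finsetSum Finset.univ
      fun k _ => integrable_finsetSum Finset.univ fun l _ => hint i j k l,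
    fun i j k => integral_finsetSum Finset.univ fun l _ => hint i j k l,
    integral_mul_const, hν.integral_stateDiff_mul]
  simp only [secondMoment, hone, Matrix.smul_apply, Matrix.sub_apply, Matrix.sum_apply,
    Matrix.sum_mul, smul_eq_mul, ite_and, mul_sub, sub_mul,
    Finset.sum_sub_distrib, mul_ite, ite_mul, ite_div, zero_div, mul_zero, zero_mul, mul_one,
    Finset.sum_ite_eq, Finset.sum_ite_eq', Finset.mem_univ, if_true, Finset.mul_sum]
  congr 1
  simp only [Finset.sum_ite_irrel, Finset.sum_const_zero, Finset.sum_ite_eq, Finset.mem_univ,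
    if_true]
  rw [Finset.sum_comm]
  refine Finset.sum_congr rfl fun k _ => Finset.sum_congr rfl fun i _ => ?_
  rw [one_div, mul_assoc]

theorem IsStateDesign.integral_trace_mul_map_sq [Nonempty ι] (hν : IsStateDesign 2 ν)
    (T : Matrix ι ι ℂ →ₗ[ℂ] Matrix κ κ ℂ) (S : Matrix κ κ ℂ) :
    ∫ p, (S * (T (stateDiff p) * T (stateDiff p))).trace ∂(ν.prod ν) =
      (S * secondMoment T).trace := by
  have hint : ∀ a b, Integrable (fun p : QState ι × QState ι =>
      S a b * (T (stateDiff p) * T (stateDiff p)) b a) (ν.prod ν) := fun a b =>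
    hν.integrable_prod (continuous_const.mul
      (((continuous_map_stateDiff T).matrix_mul (continuous_map_stateDiff T)).matrix_elem b a))
  simp only [Matrix.trace, Matrix.diag_apply, Matrix.mul_apply (M := S)]
  rw [integral_finsetSum _ fun a _ => integrable_finsetSum _ fun b _ => hint a b]
  refine Finset.sum_congr rfl fun a _ => ?_
  rw [integral_finsetSum _ fun b _ => hint a b]
  refine Finset.sum_congr rfl fun b _ => ?_
  rw [integral_const_mul, hν.integral_map_sq_apply]

theorem IsStateDesign.integral_re_trace_mul_map_sq [Nonempty ι] (hν : IsStateDesign 2 ν)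
    (T : Matrix ι ι ℂ →ₗ[ℂ] Matrix κ κ ℂ) (S : Matrix κ κ ℂ) :
    ∫ p, (S * (T (stateDiff p) * T (stateDiff p))).trace.re ∂(ν.prod ν) =
      (S * secondMoment T).trace.re := by
  rw [← hν.integral_trace_mul_map_sq]
  refine integral_re (𝕜 := ℂ) (hν.integrable_prod ?_)
  exact (continuous_const.matrix_mul
    ((continuous_map_stateDiff T).matrix_mul (continuous_map_stateDiff T))).matrix_trace

variable [DecidableEq κ]

/-- An average of squares of Hermitian matrices is positive. The positivity claim of the main
theorem is read off from this. -/
theorem IsStateDesign.secondMoment_posSemidef [Nonempty ι] (hν : IsStateDesign 2 ν)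
    {T : Matrix ι ι ℂ →ₗ[ℂ] Matrix κ κ ℂ} (hT : ∀ X, X.IsHermitian → (T X).IsHermitian) :
    (secondMoment T).PosSemidef := by
  have hherm : (secondMoment T).IsHermitian := by
    ext a b
    rw [Matrix.conjTranspose_apply, ← hν.integral_map_sq_apply T, ← hν.integral_map_sq_apply T,
      RCLike.star_def, ← integral_conj]
    refine integral_congr_ae (Filter.Eventually.of_forall fun p => ?_)
    have hX := hT _ (isHermitian_stateDiff p)
    have h2 : (T (stateDiff p) * T (stateDiff p)).IsHermitian :=
      (Matrix.IsHermitian.commute_iff hX hX).mp (Commute.refl _)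
    exact h2.apply a b
  refine Matrix.PosSemidef.of_dotProduct_mulVec_nonneg hherm fun x => ?_
  have htr : ∀ Y : Matrix κ κ ℂ, star x ⬝ᵥ Y.mulVec x = (Matrix.vecMulVec x (star x) * Y).trace :=
    fun Y => by
      rw [Matrix.vecMulVec_mul, Matrix.trace_vecMulVec, Matrix.dotProduct_mulVec, dotProduct_comm]
  refine Complex.nonneg_iff.mpr ⟨?_, (hherm.im_star_dotProduct_mulVec_self x).symm⟩
  rw [htr, ← hν.integral_re_trace_mul_map_sq]
  refine integral_nonneg fun p => ?_
  refine trace_mul_re_nonneg (Matrix.posSemidef_vecMulVec_self_star x) ?_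
  have hX := hT _ (isHermitian_stateDiff p)
  have := Matrix.posSemidef_conjTranspose_mul_self (T (stateDiff p))
  rwa [hX.eq] at this

/-- Jensen's inequality without operator concavity: S does not depend on the sample, so averaging
the variational bound replaces T(X)² by M, and S = √M + ε is asymptotically optimal. -/
theorem IsStateDesign.integral_traceNorm_le [Nonempty ι] (hν : IsStateDesign 2 ν)
    {T : Matrix ι ι ℂ →ₗ[ℂ] Matrix κ κ ℂ} (hT : ∀ X, X.IsHermitian → (T X).IsHermitian) :
    ∫ p, traceNorm (T (stateDiff p)) ∂(ν.prod ν) ≤ traceSqrt (secondMoment T) := by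
  have := hν.isProbabilityMeasure
  have hM := hν.secondMoment_posSemidef hT
  set M := secondMoment T with hMdef
  set R := CFC.sqrt M with hRdef
  have hR : R.PosSemidef := Matrix.nonneg_iff_posSemidef.mp (CFC.sqrt_nonneg M)
  refine le_of_forall_pos_le_add fun δ hδ => ?_
  obtain ⟨ε, hε, hεδ⟩ : ∃ ε : ℝ, 0 < ε ∧ ε * (Fintype.card κ : ℝ) ≤ δ := by
    refine ⟨δ / (Fintype.card κ + 1), by positivity, ?_⟩
    rw [div_mul_eq_mul_div, div_le_iff₀ (by positivity)]
    nlinarith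
  have hS := posDef_add_smul_one hR hε
  set S := R + (ε : ℂ) • (1 : Matrix κ κ ℂ) with hSdef
  have h1 : ∫ p, 2 * traceNorm (T (stateDiff p)) ∂(ν.prod ν) ≤
      ∫ p, ((S⁻¹ * (T (stateDiff p) * T (stateDiff p))).trace.re + S.trace.re) ∂(ν.prod ν) := by
    refine integral_mono (hν.integrable_prod ?_) (hν.integrable_prod ?_) fun p =>
      two_mul_traceNorm_le (hT _ (isHermitian_stateDiff p)) hS
    · exact continuous_const.mul (continuous_traceNorm.comp (continuous_map_stateDiff T))
    · exact (Complex.continuous_re.comp (continuous_const.matrix_mul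
        ((continuous_map_stateDiff T).matrix_mul
          (continuous_map_stateDiff T))).matrix_trace).add continuous_const
  have hi : Integrable (fun p => (S⁻¹ * (T (stateDiff p) * T (stateDiff p))).trace.re)
      (ν.prod ν) := hν.integrable_prod (Complex.continuous_re.comp
    (continuous_const.matrix_mul ((continuous_map_stateDiff T).matrix_mul
      (continuous_map_stateDiff T))).matrix_trace)
  rw [integral_const_mul, integral_add hi (integrable_const _),
    hν.integral_re_trace_mul_map_sq, integral_const, probReal_univ, one_smul, ← hMdef] at h1
  have h2 := trace_inv_mul_sq_le hR hε
  rw [← hSdef, hRdef, CFC.sqrt_mul_sqrt_self M hM.nonneg, ← hRdef] at h2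
  have h4 : S.trace.re = R.trace.re + ε * Fintype.card κ := by
    rw [hSdef, Matrix.trace_add, Matrix.trace_smul, Matrix.trace_one]
    simp
  rw [traceSqrt, ← hRdef]
  linarith

/-- By independence the average is Tr((I/D)²). -/
theorem IsStateDesign.integral_overlap [Nonempty ι] (hν : IsStateDesign 2 ν) :
    ∫ p : QState ι × QState ι, (p.1.1 * p.2.1).trace.re ∂(ν.prod ν) =
      (Fintype.card ι : ℝ)⁻¹ := by
  have hD : (Fintype.card ι : ℂ) ≠ 0 := by exact_mod_cast Fintype.card_ne_zero
  have hint : ∀ a b, Integrable (fun p : QState ι × QState ι => p.1.1 a b * p.2.1 b a)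
      (ν.prod ν) := fun a b => hν.integrable_prod
    (((continuous_entry a b).comp continuous_fst).mul ((continuous_entry b a).comp continuous_snd))
  have h : ∫ p : QState ι × QState ι, (p.1.1 * p.2.1).trace ∂(ν.prod ν) =
      (Fintype.card ι : ℂ)⁻¹ := by
    simp only [Matrix.trace, Matrix.diag_apply, Matrix.mul_apply]
    rw [integral_finsetSum _ fun a _ => integrable_finsetSum _ fun b _ => hint a b]
    simp_rw [fun a => integral_finsetSum Finset.univ fun b _ => hint a b,
      hν.integral_fst_mul_snd]
    simp only [ite_div, zero_div, mul_ite, ite_mul, zero_mul, mul_zero,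
      Finset.sum_ite_eq', Finset.mem_univ, if_true, Finset.sum_const, Finset.card_univ,
      nsmul_eq_mul]
    field_simp
  have h2 := congrArg Complex.re h
  rw [← Complex.ofReal_natCast, ← Complex.ofReal_inv, Complex.ofReal_re] at h2
  rw [← h2]
  refine integral_re (𝕜 := ℂ) (hν.integrable_prod ?_)
  exact ((continuous_subtype_val.comp continuous_fst).matrix_mul
    (continuous_subtype_val.comp continuous_snd)).matrix_trace

end SecondMoment

/-! ### From the output distance to the average contraction. -/

section Contraction

theorem measurableSet_ne {ι : Type} [Fintype ι] :
    MeasurableSet {p : QState ι × QState ι | p.1 ≠ p.2} :=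
  (isClosed_eq continuous_fst continuous_snd).measurableSet.compl

variable {ι : Type} [Fintype ι] [DecidableEq ι] {κ : Type} [Fintype κ] [DecidableEq κ]
  {ν : Measure (QState ι)} {T : Matrix ι ι ℂ →ₗ[ℂ] Matrix κ κ ℂ}

theorem traceDist_nonneg (X Y : Matrix ι ι ℂ) : 0 ≤ traceDist X Y :=
  mul_nonneg (by norm_num) (traceNorm_nonneg _)

theorem contractionRatio_nonneg (p : QState ι × QState ι) : 0 ≤ contractionRatio T p :=
  div_nonneg (traceDist_nonneg _ _) (traceDist_nonneg _ _)

theorem contractionRatio_le_one (hpos : ∀ X, X.PosSemidef → (T X).PosSemidef)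
    (htr : ∀ X, (T X).trace = X.trace) (p : QState ι × QState ι) : contractionRatio T p ≤ 1 := by
  refine div_le_one_of_le₀ ?_ (traceDist_nonneg _ _)
  rw [traceDist, traceDist, ← map_sub]
  exact mul_le_mul_of_nonneg_left (traceNorm_map_le hpos htr (isHermitian_stateDiff p))
    (by norm_num)

/-- For a pure state `ρ`, the contraction ratio is at most the output distance plus the overlap. -/
theorem contractionRatio_le (hpos : ∀ X, X.PosSemidef → (T X).PosSemidef)
    (htr : ∀ X, (T X).trace = X.trace) (p : QState ι × QState ι) (hp : p.1.1 * p.1.1 = p.1.1) :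
    contractionRatio T p ≤ 1 / 2 * traceNorm (T (stateDiff p)) + (p.1.1 * p.2.1).trace.re := by
  have h0 := contractionRatio_nonneg (T := T) p
  have h1 := contractionRatio_le_one hpos htr p
  have hs := trace_mul_re_nonneg p.1.2.1 p.2.2.1
  have ht := one_sub_le_traceDist p.1.2.1 p.1.2.2 hp p.2.2.1 p.2.2.2
  have hf : 1 / 2 * traceNorm (T (stateDiff p)) = traceDist (T p.1.1) (T p.2.1) := by
    rw [traceDist, stateDiff, map_sub]
  rw [hf]
  have hf0 := traceDist_nonneg (T p.1.1) (T p.2.1)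
  rcases (traceDist_nonneg p.1.1 p.2.1).eq_or_lt with h | h
  -- At distance zero the ratio is 0 by the convention x / 0 = 0.
  · have : contractionRatio T p = 0 := by rw [contractionRatio, ← h, div_zero]
    linarith
  · have hmul : contractionRatio T p * traceDist p.1.1 p.2.1 = traceDist (T p.1.1) (T p.2.1) :=
      div_mul_cancel₀ _ h.ne'
    -- With ratio r, input distance t and overlap s: r = rt + r(1 - t), where rt is the output
    -- distance and r(1 - t) ≤ rs ≤ s.
    nlinarith

theorem measurable_contractionRatio : Measurable (contractionRatio T) := by
  have h1 : Continuous fun p : QState ι × QState ι => traceDist p.1.1 p.2.1 :=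
    continuous_const.mul (continuous_traceNorm.comp continuous_stateDiff)
  have h2 : Continuous fun p : QState ι × QState ι => traceDist (T p.1.1) (T p.2.1) := by
    have := continuous_const (y := (1 / 2 : ℝ)).mul
      (continuous_traceNorm.comp (continuous_map_stateDiff T))
    refine this.congr fun p => ?_
    simp [traceDist, stateDiff]
  exact h2.measurable.div h1.measurable

/-- Two independent samples of a `2`-design coincide with probability at most `1 / D`. -/
theorem IsStateDesign.one_sub_le_measureReal_ne [Nonempty ι] (hν : IsStateDesign 2 ν) :
    1 - (Fintype.card ι : ℝ)⁻¹ ≤ (ν.prod ν).real {p | p.1 ≠ p.2} := by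
  have := hν.isProbabilityMeasure
  have hs : Integrable (fun p : QState ι × QState ι => (p.1.1 * p.2.1).trace.re) (ν.prod ν) :=
    hν.integrable_prod (Complex.continuous_re.comp
      ((continuous_subtype_val.comp continuous_fst).matrix_mul
        (continuous_subtype_val.comp continuous_snd)).matrix_trace)
  have hpure : ∀ᵐ p ∂(ν.prod ν), p.1.1 * p.1.1 = p.1.1 :=
    Measure.quasiMeasurePreserving_fst.ae hν.pure
  have h : ∫ p : QState ι × QState ι, (1 - (p.1.1 * p.2.1).trace.re) ∂(ν.prod ν) ≤
      ∫ p, ({p : QState ι × QState ι | p.1 ≠ p.2}.indicator 1 p : ℝ) ∂(ν.prod ν) := by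
    refine integral_mono_ae ((integrable_const _).sub hs)
      ((integrable_const (1 : ℝ)).indicator measurableSet_ne) ?_
    filter_upwards [hpure] with p hp
    -- If ρ = σ is pure, the overlap is 1 and both sides vanish; otherwise the left side is at most
    -- 1.
    by_cases hne : p.1 = p.2
    · have h1 := congrArg Complex.re p.1.2.2
      rw [Set.indicator_of_notMem (by simpa using hne), ← hne, hp, h1]
      simp
    · rw [Set.indicator_of_mem (by simpa using hne)]
      have := trace_mul_re_nonneg p.1.2.1 p.2.2.1
      simp only [Pi.one_apply]
      linarith
  rw [integral_indicator_one measurableSet_ne, integral_sub (integrable_const _) hs,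
    hν.integral_overlap] at h
  simpa using h

theorem IsStateDesign.measure_ne_ne_zero (hD : 2 ≤ Fintype.card ι) (hν : IsStateDesign 2 ν) :
    (ν.prod ν) {p | p.1 ≠ p.2} ≠ 0 := by
  have : Nonempty ι := Fintype.card_pos_iff.mp (by omega)
  intro h
  have h1 := hν.one_sub_le_measureReal_ne
  rw [Measure.real, h, ENNReal.toReal_zero] at h1
  have h2 : (Fintype.card ι : ℝ)⁻¹ ≤ 2⁻¹ := inv_anti₀ (by norm_num) (by exact_mod_cast hD)
  linarith

theorem IsStateDesign.isProbabilityMeasure_pairDistribution (hD : 2 ≤ Fintype.card ι)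
    (hν : IsStateDesign 2 ν) : IsProbabilityMeasure (pairDistribution ν) := by
  have := hν.isProbabilityMeasure
  exact ProbabilityTheory.cond_isProbabilityMeasure (hν.measure_ne_ne_zero hD)

theorem integrable_contractionRatio (hpos : ∀ X, X.PosSemidef → (T X).PosSemidef)
    (htr : ∀ X, (T X).trace = X.trace) (ω : Measure (QState ι × QState ι)) [IsFiniteMeasure ω] :
    Integrable (contractionRatio T) ω :=
  Integrable.of_bound measurable_contractionRatio.aestronglyMeasurable 1
    (Filter.Eventually.of_forall fun p => by
      rw [Real.norm_of_nonneg (contractionRatio_nonneg p)]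
      exact contractionRatio_le_one hpos htr p)

/-- The average contraction is bounded by the square root of the second moment of the output
difference, up to `2 / D`. -/
theorem IsStateDesign.avgContraction_le (hD : 2 ≤ Fintype.card ι) (hν : IsStateDesign 2 ν)
    (hpos : ∀ X, X.PosSemidef → (T X).PosSemidef) (htr : ∀ X, (T X).trace = X.trace) :
    avgContraction T (pairDistribution ν) ≤
      1 / 2 * traceSqrt (secondMoment T) + 2 * (Fintype.card ι : ℝ)⁻¹ := by
  have : Nonempty ι := Fintype.card_pos_iff.mp (by omega)
  have := hν.isProbabilityMeasure
  set A : Set (QState ι × QState ι) := {p | p.1 ≠ p.2} with hA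
  have hAm : MeasurableSet A := measurableSet_ne
  have hs : Integrable (fun p : QState ι × QState ι => (p.1.1 * p.2.1).trace.re) (ν.prod ν) :=
    hν.integrable_prod (Complex.continuous_re.comp
      ((continuous_subtype_val.comp continuous_fst).matrix_mul
        (continuous_subtype_val.comp continuous_snd)).matrix_trace)
  have hf : Integrable (fun p => 1 / 2 * traceNorm (T (stateDiff p))) (ν.prod ν) :=
    hν.integrable_prod (continuous_const.mul
      (continuous_traceNorm.comp (continuous_map_stateDiff T)))
  have hpure : ∀ᵐ p ∂(ν.prod ν), p.1.1 * p.1.1 = p.1.1 :=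
    Measure.quasiMeasurePreserving_fst.ae hν.pure
  have hr := integrable_contractionRatio hpos htr (ν.prod ν)
  set r := ∫ p in A, contractionRatio T p ∂(ν.prod ν) with hrdef
  set q := (ν.prod ν).real A with hq
  have hq1 : 1 - (Fintype.card ι : ℝ)⁻¹ ≤ q := hν.one_sub_le_measureReal_ne
  have hq2 : q ≤ 1 := measureReal_le_one
  have hq0 : 0 < q :=
    ENNReal.toReal_pos (hν.measure_ne_ne_zero hD) (measure_ne_top _ _)
  have havg : avgContraction T (pairDistribution ν) = q⁻¹ * r := by
    rw [avgContraction, pairDistribution, ProbabilityTheory.cond, integral_smul_measure,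
      ENNReal.toReal_inv, smul_eq_mul]
    rfl
  have hr1 : r ≤ q := by
    have h := setIntegral_mono (s := A) hr.integrableOn
      (integrable_const (1 : ℝ)).integrableOn fun p => contractionRatio_le_one hpos htr p
    simpa using h
  have hr2 : r ≤ 1 / 2 * traceSqrt (secondMoment T) + (Fintype.card ι : ℝ)⁻¹ := by
    calc r ≤ ∫ p, contractionRatio T p ∂(ν.prod ν) :=
          setIntegral_le_integral hr (Filter.Eventually.of_forall contractionRatio_nonneg)
      _ ≤ ∫ p, (1 / 2 * traceNorm (T (stateDiff p)) + (p.1.1 * p.2.1).trace.re) ∂(ν.prod ν) := by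
          refine integral_mono_ae hr (hf.add hs) ?_
          filter_upwards [hpure] with p hp using contractionRatio_le hpos htr p hp
      _ ≤ _ := by
          rw [integral_add hf hs, integral_const_mul, hν.integral_overlap]
          have := hν.integral_traceNorm_le (T := T) fun X hX => isHermitian_map hpos hX
          linarith
  have h3 : q⁻¹ * r ≤ 1 := by
    rw [inv_mul_le_iff₀ hq0, mul_one]
    exact hr1
  -- Conditioning adds at most 1 - q ≤ 1/D, because the conditional average is at most 1; with the
  -- overlap term this makes 2/D.
  have h4 : q⁻¹ * r = r + (1 - q) * (q⁻¹ * r) := by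
    field_simp
    ring
  rw [havg]
  nlinarith

end Contraction

/-! ### Tensor-power channels and the final bounds. -/

section Main

variable {d n : ℕ} {Φ : Matrix (Fin d) (Fin d) ℂ →ₗ[ℂ] Matrix (Fin d) (Fin d) ℂ}

theorem secondMoment_channelPow (hd : d ≠ 0)
    (Φ : Matrix (Fin d) (Fin d) ℂ →ₗ[ℂ] Matrix (Fin d) (Fin d) ℂ) :
    secondMoment (channelPow n Φ) = (2 / ((d : ℂ) ^ n + 1)) •
      (((d : ℂ) ^ n) • tensorPow n (partialTrace₂ (choiState Φ ^ 2))
        - tensorPow n (averageOutput Φ ^ 2)) := by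
  have : NeZero d := ⟨hd⟩
  have hc : (d : ℂ) ^ n ≠ 0 := pow_ne_zero _ (by exact_mod_cast hd)
  have hc1 : (d : ℂ) ^ n + 1 ≠ 0 := by exact_mod_cast Nat.succ_ne_zero (d ^ n)
  rw [secondMoment, sum_channelPow_single_mul, channelPow_one, Matrix.smul_mul, Matrix.mul_smul,
    tensorPow_mul, ← pow_two (averageOutput Φ)]
  simp only [Fintype.card_pi, Fintype.card_fin, Finset.prod_const, Finset.card_univ, Nat.cast_pow]
  simp only [smul_sub, smul_smul]
  congr 2 <;> field_simp

theorem channelPow_bounds (hd : 2 ≤ d) (hn : 1 ≤ n) (hΦ : IsQuantumChannel Φ)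
    {ν : Measure (QState (Fin n → Fin d))} (hν : IsStateDesign 2 ν) :
    (((d : ℂ) ^ n) • tensorPow n (partialTrace₂ (choiState Φ ^ 2))
        - tensorPow n (averageOutput Φ ^ 2)).PosSemidef ∧
    IsProbabilityMeasure (pairDistribution ν) ∧
    Integrable (contractionRatio (channelPow n Φ)) (pairDistribution ν) ∧
    avgContraction (channelPow n Φ) (pairDistribution ν) ≤
      1 / 2 * traceSqrt ((2 / ((d : ℂ) ^ n + 1)) •
        (((d : ℂ) ^ n) • tensorPow n (partialTrace₂ (choiState Φ ^ 2))
          - tensorPow n (averageOutput Φ ^ 2)))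
      + 2 / √((d : ℝ) ^ n) ∧
    avgContraction (channelPow n Φ) (pairDistribution ν) ≤
      1 / √2 * traceSqrt (partialTrace₂ (choiState Φ ^ 2)) ^ n + 2 / √((d : ℝ) ^ n) := by
  have hd0 : d ≠ 0 := by omega
  have : NeZero d := ⟨hd0⟩
  have hcard : Fintype.card (Fin n → Fin d) = d ^ n := by simp
  have hD : 2 ≤ Fintype.card (Fin n → Fin d) := by
    rw [hcard]
    exact hd.trans (Nat.le_self_pow (by omega) d)
  have hpos : ∀ X, X.PosSemidef → (channelPow n Φ X).PosSemidef := fun X hX =>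
    channelPow_posSemidef hd0 n hΦ.completelyPositive hX
  have htr := channelPow_trace n hΦ.tracePreserving
  have hsm := secondMoment_channelPow (n := n) hd0 Φ
  have hM := hν.secondMoment_posSemidef (T := channelPow n Φ) fun X hX => isHermitian_map hpos hX
  have hprob := hν.isProbabilityMeasure_pairDistribution hD
  have hA := partialTrace_choiState_sq_posSemidef hΦ.completelyPositive
  have hmain := hν.avgContraction_le hD hpos htr
  set A := partialTrace₂ (choiState Φ ^ 2) with hAdef
  set B := averageOutput Φ ^ 2 with hBdef
  have hDr : (1 : ℝ) ≤ (d : ℝ) ^ n := by exact_mod_cast Nat.one_le_pow _ _ (by omega)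
  have hDc1 : (d : ℂ) ^ n + 1 ≠ 0 := by exact_mod_cast Nat.succ_ne_zero (d ^ n)
  have herr : 2 * (Fintype.card (Fin n → Fin d) : ℝ)⁻¹ ≤ 2 / √((d : ℝ) ^ n) := by
    rw [hcard, Nat.cast_pow, div_eq_mul_inv]
    have : √((d : ℝ) ^ n) ≤ (d : ℝ) ^ n := by
      rw [Real.sqrt_le_left (by positivity)]
      nlinarith
    have hs : 0 < √((d : ℝ) ^ n) := Real.sqrt_pos.mpr (by linarith)
    exact mul_le_mul_of_nonneg_left (inv_anti₀ hs this) (by norm_num)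
  have hB : B.PosSemidef := by
    have h1 := partialTrace_posSemidef (choiState_posSemidef hΦ.completelyPositive)
    rw [partialTrace_choiState] at h1
    exact h1.pow 2
  have hpsd : (((d : ℂ) ^ n) • tensorPow n A - tensorPow n B).PosSemidef := by
    -- This factor cancels the prefactor of the second moment.
    have h := hM.smul (a := ((d : ℂ) ^ n + 1) / 2) (by
      have h0 : (0 : ℝ) ≤ ((d : ℝ) ^ n + 1) / 2 := by positivity
      simpa using Complex.zero_le_real.mpr h0)
    rw [hsm, smul_smul] at h
    have : ((d : ℂ) ^ n + 1) / 2 * (2 / ((d : ℂ) ^ n + 1)) = 1 := by field_simp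
    rwa [this, one_smul] at h
  refine ⟨hpsd, hprob, integrable_contractionRatio hpos htr _, ?_, ?_⟩
  · rw [← hsm]
    linarith
  · set R := CFC.sqrt A with hRdef
    have hR : R.PosSemidef := Matrix.nonneg_iff_posSemidef.mp (CFC.sqrt_nonneg A)
    have hRR : R * R = A := CFC.sqrt_mul_sqrt_self A hA.nonneg
    have h2 : (0 : ℂ) ≤ (√2 : ℝ) := by exact_mod_cast Real.sqrt_nonneg 2
    have hle : traceSqrt (secondMoment (channelPow n Φ)) ≤
        (((√2 : ℝ) : ℂ) • tensorPow n R).trace.re := by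
      refine traceSqrt_le_of_le_sq hM ((tensorPow_posSemidef n hR).smul h2) ?_
      have hsq : ((√2 : ℝ) : ℂ) * ((√2 : ℝ) : ℂ) = 2 := by
        rw [← Complex.ofReal_mul, Real.mul_self_sqrt (by norm_num)]
        norm_num
      -- The gap 2A^{⊗n} - M equals 2/(D+1) (A^{⊗n} + B^{⊗n}), which is visibly positive.
      have hdecomp : ((√2 : ℝ) : ℂ) • tensorPow n R * ((√2 : ℝ) : ℂ) • tensorPow n R -
          secondMoment (channelPow n Φ) =
          (2 / ((d : ℂ) ^ n + 1)) • (tensorPow n A + tensorPow n B) := by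
        rw [Matrix.smul_mul, Matrix.mul_smul, tensorPow_mul, hRR, smul_smul, hsq, hsm]
        match_scalars <;> field_simp
        ring
      rw [hdecomp]
      exact ((tensorPow_posSemidef n hA).add (tensorPow_posSemidef n hB)).smul (by
        have h0 : (0 : ℝ) ≤ 2 / ((d : ℝ) ^ n + 1) := by positivity
        simpa using Complex.zero_le_real.mpr h0)
    have htrR : (((√2 : ℝ) : ℂ) • tensorPow n R).trace.re = √2 * traceSqrt A ^ n := by
      have him : R.trace = ((traceSqrt A : ℝ) : ℂ) := by
        refine Complex.ext (by simp [traceSqrt, hRdef]) ?_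
        simpa using (Complex.nonneg_iff.mp hR.trace_nonneg).2.symm
      rw [Matrix.trace_smul, tensorPow, trace_tensorProd, Finset.prod_const, Finset.card_univ,
        Fintype.card_fin, him, smul_eq_mul, ← Complex.ofReal_pow, ← Complex.ofReal_mul,
        Complex.ofReal_re]
    have h12 : 1 / 2 * √2 = 1 / √2 := by
      rw [eq_div_iff (by positivity), mul_assoc, Real.mul_self_sqrt (by norm_num)]
      norm_num
    rw [htrR] at hle
    rw [← h12]
    nlinarith

end Main

end QContraction

theorem mainTheorem8 :
    (∃ C : ℝ, ∀ d n : ℕ, 2 ≤ d → 1 ≤ n →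
      ∀ Φ : Matrix (Fin d) (Fin d) ℂ →ₗ[ℂ] Matrix (Fin d) (Fin d) ℂ, IsQuantumChannel Φ →
      ∀ ν : Measure (QState (Fin n → Fin d)), IsStateDesign 2 ν →
        (((d : ℂ) ^ n) • tensorPow n (partialTrace₂ (choiState Φ ^ 2))
            - tensorPow n (averageOutput Φ ^ 2)).PosSemidef ∧
        IsProbabilityMeasure (pairDistribution ν) ∧
        Integrable (contractionRatio (channelPow n Φ)) (pairDistribution ν) ∧
        avgContraction (channelPow n Φ) (pairDistribution ν) ≤
          1 / 2 * traceSqrt ((2 / ((d : ℂ) ^ n + 1)) •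
            (((d : ℂ) ^ n) • tensorPow n (partialTrace₂ (choiState Φ ^ 2))
              - tensorPow n (averageOutput Φ ^ 2)))
          + C / √((d : ℝ) ^ n) ∧
        avgContraction (channelPow n Φ) (pairDistribution ν) ≤
          1 / √2 * traceSqrt (partialTrace₂ (choiState Φ ^ 2)) ^ n + C / √((d : ℝ) ^ n)) ∧
    (∀ d : ℕ, 2 ≤ d →
      ∀ Φ : Matrix (Fin d) (Fin d) ℂ →ₗ[ℂ] Matrix (Fin d) (Fin d) ℂ, IsQuantumChannel Φ →
      traceSqrt (partialTrace₂ (choiState Φ ^ 2)) < 1 →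
      ∃ K c : ℝ, 0 < c ∧ c < 1 ∧ ∀ n : ℕ, 1 ≤ n →
        ∀ ν : Measure (QState (Fin n → Fin d)), IsStateDesign 2 ν →
          avgContraction (channelPow n Φ) (pairDistribution ν) ≤ K * c ^ n) := by
  refine ⟨⟨2, fun d n hd hn Φ hΦ ν hν => channelPow_bounds hd hn hΦ hν⟩, fun d hd Φ hΦ hlt => ?_⟩
  have hd1 : (1 : ℝ) < √d := by
    rw [Real.lt_sqrt (by norm_num)]
    norm_num
    exact_mod_cast hd
  set t := traceSqrt (partialTrace₂ (choiState Φ ^ 2)) with ht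
  have ht0 : 0 ≤ t := traceSqrt_nonneg _
  have hi0 : 0 < (√d : ℝ)⁻¹ := inv_pos.mpr (by linarith)
  -- The rate must dominate both t and the rate d^{-1/2} of the error term, which also makes it
  -- positive; K adds the two prefactors.
  refine ⟨1 / √2 + 2, max t (√d)⁻¹, lt_max_of_lt_right hi0, max_lt hlt (inv_lt_one_of_one_lt₀ hd1),
    fun n hn ν hν => (channelPow_bounds hd hn hΦ hν).2.2.2.2.trans ?_⟩
  have h1 : t ^ n ≤ max t (√d)⁻¹ ^ n := pow_le_pow_left₀ ht0 (le_max_left _ _) n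
  have h2 : (√d : ℝ)⁻¹ ^ n ≤ max t (√d)⁻¹ ^ n := pow_le_pow_left₀ hi0.le (le_max_right _ _) n
  have h3 : 2 / √((d : ℝ) ^ n) = 2 * (√d : ℝ)⁻¹ ^ n := by
    have h4 : (d : ℝ) ^ n = (√(d : ℝ) ^ n) ^ 2 := by
      rw [← pow_mul, mul_comm, pow_mul, Real.sq_sqrt (Nat.cast_nonneg d)]
    rw [h4, Real.sqrt_sq (by positivity), inv_pow, div_eq_mul_inv]
  rw [h3, add_mul]
  exact add_le_add (mul_le_mul_of_nonneg_left h1 (by positivity))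
    (mul_le_mul_of_nonneg_left h2 (by norm_num))
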